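/- Let $G$ be a unimodular (real, finite-dimensional, second countable, Hausdorff) Lie group with a fixed Haar measure. A Hilbert $G$-module is a complex Hilbert space with a strongly continuous unitary action of $G$ which embeds isometrically and $G$-equivariantly into a free module $L^2(G)\otimes\mathcal H$ ($\mathcal H$ a Hilbert space), on which $s\in G$ acts by $R_s\otimes \mathbf 1$, $(R_su)(t)=u(ts)$. For a closed $G$-invariant subspace $V$ of a Hilbert $G$-module let $\dim_G V=\mathrm{Tr}_G(P_V)\in[0,\infty]$, where $P_V$ is the orthogonal projection onto the image of $V$ in $L^2(G)\otimes\mathcal H\cong\bigoplus_i L^2(G)$ and, for positive $G$-equivariant $A$ with matrix entries $A_{ij}$, $\mathrm{Tr}_G(A)=\sum_i \mathrm{tr}_G(A_{ii})$; here $\mathrm{tr}_G(L_f^*L_f)=\int_G|f|^2$ if $f\in L^2(G)$ and the left convolution operator $(L_fu)(t)=\int_G f(s)u(s^{-1}t)\,ds$ is bounded on $L^2(G)$, and $\mathrm{tr}_G(T)=\infty$ for positive $G$-equivariant $T$ not of the form $L_f^*L_f$. A closed, densely defined linear operator $A:\mathcal H_1\to\mathcal H_2$ between Hilbert $G$-modules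 that commutes with the action of $G$ is called $G$-Fredholm if (i) $\dim_G\ker A<\infty$, and (ii) there is a closed $G$-invariant subspace $Q\subset \mathcal H_2$ with $Q\subset\mathrm{im}\,A$ and $\dim_G(\mathcal H_2\ominus Q)<\infty$. **Lemma.** Let $A:\mathcal H_1\to\mathcal H_2$ be $G$-Fredholm with domain $\mathrm{dom}\,A$, and let $L\subset\mathcal H_1$ be a closed $G$-invariant subspace. Put $A(L)=\{Ax: x\in L\cap\mathrm{dom}\,A\}$ and let $A|_L:L\to\overline{A(L)}$ be the restriction of $A$, with domain $L\cap \mathrm{dom}\,A$. Then $A|_L$ is closed, commutes with $G$, and satisfies (i) and (ii) as an operator between the Hilbert $G$-modules $L$ and $\overline{A(L)}$. Consequently, if $L\cap\mathrm{dom}\,A$ is dense in $L$ (for instance if $A$ is bounded and everywhere defined), then $A|_L:L\to\overline{A(L)}$ is $G$-Fredholm. -/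

import Mathlib

open MeasureTheory
open scoped ENNReal InnerProductSpace Manifold ContDiff

noncomputable section

namespace GFredholm

universe u v w

section Group

variable {G : Type v} [Group G] [TopologicalSpace G] [IsTopologicalGroup G]
  [MeasurableSpace G] [BorelSpace G]

/-- Right translation on `L²(G)`, `(R_s f)(t) = f (t s)`; the measure is a right invariant
(in the application: bi-invariant) Haar measure. -/
def rightTranslation (μ : Measure G) [μ.IsMulRightInvariant] (s : G) :
    Lp ℂ 2 μ →ₗᵢ[ℂ] Lp ℂ 2 μ :=
  Lp.compMeasurePreservingₗᵢ ℂ (fun t : G => t * s) (measurePreserving_mul_right μ s)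

/-- `B = L_f`: the bounded operator `B` on `L²(G)` is the continuous extension of left convolution
`(L_f u)(t) = ∫ f(s) u(s⁻¹ t) ds`, initially defined for compactly supported continuous `u`. -/
def IsLeftConvolution (μ : Measure G) (f : Lp ℂ 2 μ) (B : Lp ℂ 2 μ →L[ℂ] Lp ℂ 2 μ) : Prop :=
  ∀ u : G → ℂ, Continuous u → HasCompactSupport u →
    ∀ v : Lp ℂ 2 μ, v =ᵐ[μ] u → B v =ᵐ[μ] fun t => ∫ s, f s * u (s⁻¹ * t) ∂μ

/-- The trace `tr_G` on positive right invariant operators `T` on `L²(G)`: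
`tr_G (L_f^* L_f) = ∫ |f|²` when `f ∈ L²(G)` and `L_f` is bounded, and `tr_G T = ∞` when `T` is not
of the form `L_f^* L_f`. (The value does not depend on `f`, so the infimum is that value.) -/
def trG (μ : Measure G) (T : Lp ℂ 2 μ →L[ℂ] Lp ℂ 2 μ) : ℝ≥0∞ :=
  ⨅ (f : Lp ℂ 2 μ) (B : Lp ℂ 2 μ →L[ℂ] Lp ℂ 2 μ)
    (_ : IsLeftConvolution μ f B ∧ B.adjoint ∘L B = T), ∫⁻ s, ‖f s‖ₑ ^ 2 ∂μ

/-- The free Hilbert `G`-module `L²(G) ⊗ ℓ²(ι)`, written as the Hilbert sum `⨁_{i ∈ ι} L²(G)`.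
Every Hilbert space is isometric to some `ℓ²(ι)`, so these are all free Hilbert `G`-modules
`L²(G) ⊗ H`. The action `R_s ⊗ 1` is right translation in every coordinate. -/
abbrev FreeModule (μ : Measure G) (ι : Type u) : Type (max u v) :=
  lp (fun _ : ι => Lp ℂ 2 μ) 2

/-- The diagonal matrix entry `A_ii : L²(G) → L²(G)` of an operator on `⨁_i L²(G)`. -/
def diagEntry (μ : Measure G) {ι : Type u} [DecidableEq ι]
    (A : FreeModule μ ι →L[ℂ] FreeModule μ ι) (i : ι) : Lp ℂ 2 μ →L[ℂ] Lp ℂ 2 μ :=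
  lp.evalCLM ℂ (fun _ : ι => Lp ℂ 2 μ) 2 i ∘L A ∘L
    lp.singleContinuousLinearMap ℂ (fun _ : ι => Lp ℂ 2 μ) 2 i

open Classical in
/-- `Tr_G A = ∑_i tr_G (A_ii)` for a positive invariant operator `A` on `⨁_i L²(G)`. -/
def TrG (μ : Measure G) {ι : Type u} (A : FreeModule μ ι →L[ℂ] FreeModule μ ι) : ℝ≥0∞ :=
  ∑' i, trG μ (diagEntry μ A i)

/-- The isometry `J` from a Hilbert space with an action `rep` of `G` to the free Hilbert
`G`-module `⨁_i L²(G)` is `G`-equivariant. -/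
def IsEquivariantEmbedding (μ : Measure G) [μ.IsMulRightInvariant] {V : Type u}
    [NormedAddCommGroup V] [InnerProductSpace ℂ V] (rep : G →* (V ≃ₗᵢ[ℂ] V)) {ι : Type u}
    (J : V →ₗᵢ[ℂ] FreeModule μ ι) : Prop :=
  ∀ (s : G) (x : V) (i : ι), (J (rep s x) : ι → Lp ℂ 2 μ) i =
    rightTranslation μ s ((J x : ι → Lp ℂ 2 μ) i)

/-- A (projective) Hilbert `G`-module structure on the complex Hilbert space `V`: a strongly
continuous unitary action of `G` that embeds isometrically and equivariantly into a free Hilbert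
`G`-module. (Each vector has only countably many nonzero coordinates, so index types in the
universe of `V` suffice.) -/
structure HilbertGModule (μ : Measure G) [μ.IsMulRightInvariant] (V : Type u)
    [NormedAddCommGroup V] [InnerProductSpace ℂ V] [CompleteSpace V] where
  rep : G →* (V ≃ₗᵢ[ℂ] V)
  continuous_rep : ∀ x : V, Continuous fun s => rep s x
  projective : ∃ (ι : Type u) (J : V →ₗᵢ[ℂ] FreeModule μ ι), IsEquivariantEmbedding μ rep J

variable {μ : Measure G} [μ.IsMulRightInvariant]
variable {V : Type u} [NormedAddCommGroup V] [InnerProductSpace ℂ V] [CompleteSpace V]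
variable {W : Type w} [NormedAddCommGroup W] [InnerProductSpace ℂ W] [CompleteSpace W]

namespace HilbertGModule

/-- The subspace `L` is `G`-invariant. -/
def IsInvariant (M : HilbertGModule μ V) (L : Submodule ℂ V) : Prop :=
  ∀ (s : G), ∀ x ∈ L, M.rep s x ∈ L

/-- `dim_G L = Tr_G (P_{J L})` for a closed invariant subspace `L`, where `J` is an equivariant
isometric embedding of the module into a free one and `P_{J L}` is the orthogonal projection onto
`J L`. (The value does not depend on `J`, so the infimum is that value; for closed `L` the image
`J L` is closed, and the closure below only serves to have a projection for every `L`.) -/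
def dim (M : HilbertGModule μ V) (L : Submodule ℂ V) : ℝ≥0∞ :=
  ⨅ (ι : Type u) (J : V →ₗᵢ[ℂ] FreeModule μ ι) (_ : IsEquivariantEmbedding μ M.rep J),
    TrG μ (L.map J.toLinearMap).topologicalClosure.starProjection

/-- A closed `G`-invariant subspace (a Hilbert submodule). -/
structure ClosedInvariant (M : HilbertGModule μ V) where
  carrier : Submodule ℂ V
  isClosed : IsClosed (carrier : Set V)
  invariant : M.IsInvariant carrier

instance (M : HilbertGModule μ V) (L : M.ClosedInvariant) : CompleteSpace L.carrier :=
  L.isClosed.completeSpace_coe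

/-- The action on a closed invariant subspace. -/
def subRep (M : HilbertGModule μ V) (L : M.ClosedInvariant) :
    G →* (L.carrier ≃ₗᵢ[ℂ] L.carrier) where
  toFun s :=
    { toFun := fun x => ⟨M.rep s x, L.invariant s x x.2⟩
      invFun := fun x => ⟨M.rep s⁻¹ x, L.invariant s⁻¹ x x.2⟩
      left_inv := fun x => Subtype.ext (by
        change (M.rep s⁻¹ * M.rep s) (x : V) = x
        rw [← map_mul, inv_mul_cancel, map_one]; rfl)
      right_inv := fun x => Subtype.ext (by
        change (M.rep s * M.rep s⁻¹) (x : V) = x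
        rw [← map_mul, mul_inv_cancel, map_one]; rfl)
      map_add' := fun x y => Subtype.ext (by simp)
      map_smul' := fun c x => Subtype.ext (by simp)
      norm_map' := fun x => (M.rep s).norm_map (x : V) }
  map_one' := by
    ext x
    change M.rep 1 (x : V) = x
    rw [map_one]; rfl
  map_mul' s t := by
    ext x
    change M.rep (s * t) (x : V) = M.rep s (M.rep t x)
    rw [map_mul]; rfl

/-- A closed invariant subspace as a Hilbert `G`-module. -/
def restrict (M : HilbertGModule μ V) (L : M.ClosedInvariant) :
    HilbertGModule μ L.carrier where
  rep := M.subRep L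
  continuous_rep x := (M.continuous_rep (x : V)).subtype_mk _
  projective := by
    obtain ⟨ι, J, hJ⟩ := M.projective
    exact ⟨ι, J.comp L.carrier.subtypeₗᵢ, fun s x i => hJ s (x : V) i⟩

end HilbertGModule

/-- The (possibly unbounded) operator `A` commutes with the actions of `G`; in particular its
domain is invariant. -/
def CommutesWithAction (M : HilbertGModule μ V) (N : HilbertGModule μ W)
    (A : V →ₗ.[ℂ] W) : Prop :=
  ∀ (s : G) (x : A.domain), ∃ h : M.rep s (x : V) ∈ A.domain, A ⟨M.rep s x, h⟩ = N.rep s (A x)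

/-- The kernel of a partially defined operator, as a subspace of the source space. -/
def kernel (A : V →ₗ.[ℂ] W) : Submodule ℂ V :=
  (LinearMap.ker A.toFun).map A.domain.subtype

/-- All requirements in the definition of a `G`-Fredholm operator other than density of the domain:
`A` is closed, commutes with `G`, `dim_G ker A < ∞`, and there is a closed invariant subspace
`Q ⊆ im A` with `dim_G Q^⊥ < ∞`. -/
structure FredholmConditions (M : HilbertGModule μ V) (N : HilbertGModule μ W)
    (A : V →ₗ.[ℂ] W) : Prop where
  closed : A.IsClosed
  commutes : CommutesWithAction M N A
  dim_kernel_lt_top : M.dim (kernel A) < ⊤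
  exists_codim_lt_top : ∃ Q : N.ClosedInvariant,
    Q.carrier ≤ LinearMap.range A.toFun ∧ N.dim Q.carrierᗮ < ⊤

/-- `A` is a `G`-Fredholm operator between Hilbert `G`-modules (closed and densely defined,
not necessarily bounded). -/
structure IsGFredholm (M : HilbertGModule μ V) (N : HilbertGModule μ W)
    (A : V →ₗ.[ℂ] W) : Prop extends FredholmConditions M N A where
  dense_domain : Dense (A.domain : Set V)

/-- The image `A(L) = {A x | x ∈ dom A ∩ L}`. -/
def image (A : V →ₗ.[ℂ] W) (L : Submodule ℂ V) : Submodule ℂ W :=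
  (L.comap A.domain.subtype).map A.toFun

/-- The closure of `A(L)`, as a closed invariant subspace. -/
def closureImage {M : HilbertGModule μ V} {N : HilbertGModule μ W} {A : V →ₗ.[ℂ] W}
    (hA : CommutesWithAction M N A) (L : M.ClosedInvariant) : N.ClosedInvariant where
  carrier := (image A L.carrier).topologicalClosure
  isClosed := Submodule.isClosed_topologicalClosure _
  invariant s y hy := by
    have hmaps : Set.MapsTo (N.rep s) (image A L.carrier : Set W) (image A L.carrier) := by
      rintro _ ⟨x, hx, rfl⟩
      obtain ⟨h, e⟩ := hA s x
      exact ⟨⟨M.rep s x, h⟩, L.invariant s x hx, e⟩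
    have hy' : y ∈ closure (image A L.carrier : Set W) := hy
    exact hmaps.closure (N.rep s).continuous hy'

/-- The restriction `A|_L : L → closure (A(L))`, with domain `dom A ∩ L`. -/
def restriction {M : HilbertGModule μ V} {N : HilbertGModule μ W} {A : V →ₗ.[ℂ] W}
    (hA : CommutesWithAction M N A) (L : M.ClosedInvariant) :
    L.carrier →ₗ.[ℂ] (closureImage hA L).carrier where
  domain := A.domain.comap L.carrier.subtype
  toFun :=
    { toFun := fun x => ⟨A ⟨x.1.1, x.2⟩,
        Submodule.le_topologicalClosure _ ⟨⟨x.1.1, x.2⟩, x.1.2, rfl⟩⟩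
      map_add' := fun x y => Subtype.ext (A.map_add ⟨x.1.1, x.2⟩ ⟨y.1.1, y.2⟩)
      map_smul' := fun c x => Subtype.ext (A.map_smul c ⟨x.1.1, x.2⟩) }

end Group

end GFredholm

end

/-! Finiteness of `dim_G` is first made independent of the ambient module. An operator `T : L²(G) →
V` has symbol `k` if `T u = ∫ u(s) π(s⁻¹) k ds`; for `V = L²(G)` these are exactly the bounded
`L_f`, with `k = f`. An intertwiner `T` satisfies `tr_G(T* T) < ∞` iff it has a symbol
(`exists_hasSymbol_of_trG_lt_top`, `HasSymbol.trG_le`). Hence `dim_G L < ∞` iff `L` is the image of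
a coisometry from a sum of copies of `L²(G)` whose components have square summable symbols
(`FiniteGDim`). Bounded intertwiners carry symbols to symbols, so by polar decomposition a
representation has finite `G`-dimension as soon as two intertwiners into such representations are
jointly injective on it (`FiniteGDim.of_injective_pair`). In particular `L ∩ ker A`, sitting inside
`ker A`, has finite dimension.

For condition (ii), let `Γ` be the closed invariant graph of `A` over `L ∩ dom A`, and let `(B v, S
v)` be the orthogonal projection of `(0, v)` onto `Γ`. If `a = A|_L` is densely defined, then `B =
a*(1 + aa*)⁻¹` and `S = aa*(1 + aa*)⁻¹`, but the projection makes sense without density. The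
operator `S` is positive and its range lies in `A(L)`. For `δ > 0` the subspace `Q' = ker (δ - S)⁺`,
on which `S ≥ δ`, lies in the range of `S`, hence in `A(L)`.

It remains to bound the complement of `Q'` in the closure of `A(L)`. There `‖S v‖² ≤ δ⟨v, S v⟩ =
δ(‖B v‖² + ‖S v‖²)`. By the open mapping theorem `‖B v‖ ≤ c‖S v‖` whenever `B v ⊥ ker A` and `S v ∈
Q`. If `δ(c² + 1) < 1`, these force `S v = 0` and `B v = 0`, so `v ⊥ A(L)` and `v = 0`. Thus the
components of `B v` in `ker A` and of `S v` in `Q^⊥` determine `v`, and both targets have finite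
dimension. -/

noncomputable section

namespace GFredholm

/-! ### Intertwiners of unitary representations -/

section UnitaryRepresentations

variable {G : Type*} [Group G]
variable {V : Type*} [NormedAddCommGroup V] [InnerProductSpace ℂ V]
variable {W : Type*} [NormedAddCommGroup W] [InnerProductSpace ℂ W]
variable {X : Type*} [NormedAddCommGroup X] [InnerProductSpace ℂ X]
variable {π : G →* (V ≃ₗᵢ[ℂ] V)} {ρ : G →* (W ≃ₗᵢ[ℂ] W)} {σ : G →* (X ≃ₗᵢ[ℂ] X)}

/-- The bounded operator `C` intertwines the unitary representations `π` and `ρ`. -/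
def Intertwines (π : G →* (V ≃ₗᵢ[ℂ] V)) (ρ : G →* (W ≃ₗᵢ[ℂ] W)) (C : V →L[ℂ] W) : Prop :=
  ∀ s x, C (π s x) = ρ s (C x)

theorem rep_rep_inv (π : G →* (V ≃ₗᵢ[ℂ] V)) (s : G) (x : V) : π s (π s⁻¹ x) = x := by
  change (π s * π s⁻¹) x = x
  rw [← map_mul, mul_inv_cancel, map_one]; rfl

theorem inner_rep_left (π : G →* (V ≃ₗᵢ[ℂ] V)) (s : G) (x y : V) :
    ⟪π s x, y⟫_ℂ = ⟪x, π s⁻¹ y⟫_ℂ := by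
  conv_lhs => rw [← rep_rep_inv π s y]
  exact (π s).inner_map_map _ _

theorem Intertwines.comp {C : W →L[ℂ] X} {B : V →L[ℂ] W} (hC : Intertwines ρ σ C)
    (hB : Intertwines π ρ B) : Intertwines π σ (C ∘L B) := fun s x => by
  simp [hB s x, hC s (B x)]

theorem Intertwines.adjoint [CompleteSpace V] [CompleteSpace W] {C : V →L[ℂ] W}
    (hC : Intertwines π ρ C) : Intertwines ρ π C.adjoint := fun s y => by
  refine ext_inner_right ℂ fun x => ?_
  rw [ContinuousLinearMap.adjoint_inner_left, inner_rep_left, inner_rep_left,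
    ContinuousLinearMap.adjoint_inner_left, hC]

theorem Intertwines.of_denseRange {C : V →L[ℂ] W} {ι : Type*} {e : ι → V} (he : DenseRange e)
    (h : ∀ s i, C (π s (e i)) = ρ s (C (e i))) : Intertwines π ρ C := fun s x =>
  he.induction_on (p := fun x => C (π s x) = ρ s (C x)) x
    (isClosed_eq (C.continuous.comp (π s).continuous) ((ρ s).continuous.comp C.continuous)) (h s)

/-- Douglas' factorization, equivariantly: if `‖S x‖ ≤ ‖T x‖` for all `x`, then `S = R T` for an
intertwining contraction `R`. -/
theorem exists_intertwines_comp_eq [CompleteSpace V] [CompleteSpace W]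
    {T : X →L[ℂ] V} {S : X →L[ℂ] W} (hT : Intertwines σ π T) (hS : Intertwines σ ρ S)
    (h : ∀ x, ‖S x‖ ≤ ‖T x‖) :
    ∃ R : V →L[ℂ] W, Intertwines π ρ R ∧ (∀ x, R (T x) = S x) ∧ ∀ y, ‖R y‖ ≤ ‖y‖ := by
  set K : Submodule ℂ V := (LinearMap.range T.toLinearMap).topologicalClosure with hK
  have hTK : ∀ x, T x ∈ K := fun x => Submodule.le_topologicalClosure _ ⟨x, rfl⟩
  have : CompleteSpace K := (Submodule.isClosed_topologicalClosure _).completeSpace_coe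
  let e : X →ₗ[ℂ] K := T.toLinearMap.codRestrict K hTK
  have he : DenseRange e := by
    intro y
    rw [Metric.mem_closure_iff]
    intro ε hε
    obtain ⟨_, ⟨x, rfl⟩, hx⟩ := Metric.mem_closure_iff.1 (show (y : V) ∈ closure _ from y.2) ε hε
    exact ⟨e x, ⟨x, rfl⟩, hx⟩
  have hb : ∀ x, ‖S.toLinearMap x‖ ≤ 1 * ‖e x‖ := fun x => by simpa using! h x
  let R₀ : K →L[ℂ] W := S.toLinearMap.extendOfNorm e
  have hR₀ : ∀ x, R₀ (e x) = S x := fun x => LinearMap.extendOfNorm_eq he ⟨1, hb⟩ x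
  have hR₀n : ∀ y, ‖R₀ y‖ ≤ ‖y‖ := fun y => by
    simpa using LinearMap.norm_extendOfNorm_apply_le he 1 hb y
  have hπK : ∀ s, ∀ y ∈ K, π s y ∈ K := by
    intro s y hy
    have hm : Set.MapsTo (π s) (LinearMap.range T.toLinearMap : Set V)
        (LinearMap.range T.toLinearMap) := by
      rintro _ ⟨x, rfl⟩
      exact ⟨σ s x, hT s x⟩
    exact hm.closure (π s).continuous hy
  -- `K` is invariant under the whole group, hence so is its complement, and the projection is
  -- equivariant.
  have hP : ∀ s y,
      (K.orthogonalProjectionOnto (π s y) : V) = π s (K.orthogonalProjectionOnto y) := by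
    intro s y
    refine (Submodule.eq_starProjection_of_mem_of_inner_eq_zero (hπK s _ (Subtype.mem _)) ?_)
    intro w hw
    rw [← map_sub, inner_rep_left]
    exact Submodule.starProjection_inner_eq_zero _ _ (hπK _ _ hw)
  -- `R` is the continuous extension of `T x ↦ S x` to `K`, and zero on `Kᗮ`.
  refine ⟨R₀ ∘L K.orthogonalProjectionOnto, ?_, ?_, ?_⟩
  · intro s y
    have key : ∀ (z w : K), (w : V) = π s z → R₀ w = ρ s (R₀ z) := by
      intro z
      refine he.induction_on (p := fun z : K => ∀ w : K, (w : V) = π s z → R₀ w = ρ s (R₀ z)) z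
        ?_ ?_
      · have : {z : K | ∀ w : K, (w : V) = π s z → R₀ w = ρ s (R₀ z)} =
            {z : K | R₀ ⟨π s z, hπK s z z.2⟩ = ρ s (R₀ z)} := by
          ext z
          refine ⟨fun h => h _ rfl, fun h w hw => ?_⟩
          rw [← h]; congr 1; exact Subtype.ext hw
        rw [this]
        refine isClosed_eq (R₀.continuous.comp ?_) ((ρ s).continuous.comp R₀.continuous)
        exact ((π s).continuous.comp continuous_subtype_val).subtype_mk _
      · intro x w hw
        have : w = e (σ s x) := Subtype.ext (hw.trans (hT s x).symm)
        rw [this, hR₀, hR₀, hS]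
    exact key _ _ (hP s y)
  · intro x
    have : K.orthogonalProjectionOnto (T x) = e x :=
      Submodule.orthogonalProjectionOnto_mem_subspace_eq_self (K := K) (e x)
    simp only [ContinuousLinearMap.comp_apply, this, hR₀]
  · intro y
    exact (hR₀n _).trans (Submodule.norm_orthogonalProjectionOnto_apply_le _ _)

/-- The square root of an intertwining operator is intertwining. -/
theorem Intertwines.sqrt [CompleteSpace V] {C : V →L[ℂ] V} (hC : Intertwines π π C) :
    Intertwines π π (CFC.sqrt C) := fun s x => by
  have hc : Commute C ((π s).toContinuousLinearEquiv : V →L[ℂ] V) := by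
    ext y; exact hC s y
  have := hc.cfc_nnreal NNReal.sqrt
  rw [← CFC.sqrt_eq_cfc] at this
  exact congrArg (fun B : V →L[ℂ] V => B x) this

theorem Intertwines.cfc_real [CompleteSpace V] {C : V →L[ℂ] V} (hC : Intertwines π π C)
    (f : ℝ → ℝ) : Intertwines π π (cfc f C) := fun s x => by
  have hc : Commute C ((π s).toContinuousLinearEquiv : V →L[ℂ] V) := by
    ext y; exact hC s y
  exact congrArg (fun B : V →L[ℂ] V => B x) (hc.cfc_real f)

/-- A positive intertwining operator has an intertwining self-adjoint square root. -/
theorem Intertwines.exists_sqrt [CompleteSpace V] {C : V →L[ℂ] V} (hC : Intertwines π π C)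
    (h0 : 0 ≤ C) : ∃ D : V →L[ℂ] V, Intertwines π π D ∧ D.adjoint = D ∧ D ∘L D = C := by
  refine ⟨CFC.sqrt C, hC.sqrt, ?_, CFC.sqrt_mul_sqrt_self C h0⟩
  exact (CFC.sqrt_nonneg C).isSelfAdjoint.adjoint_eq

end UnitaryRepresentations

end GFredholm
end

/-! ### Symbols of operators on `L²(G)` -/

noncomputable section

namespace GFredholm

theorem lintegral_enorm_sq_eq {G : Type*} [MeasurableSpace G] {μ : Measure G} (f : Lp ℂ 2 μ) :
    ∫⁻ s, ‖f s‖ₑ ^ 2 ∂μ = ‖f‖ₑ ^ 2 := by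
  rw [Lp.enorm_def, eLpNorm_eq_lintegral_rpow_enorm_toReal (by simp) (by simp),
    ← ENNReal.rpow_natCast, ← ENNReal.rpow_mul]
  simp

section Symbols

variable {G : Type*} [Group G] [TopologicalSpace G] [IsTopologicalGroup G] [MeasurableSpace G]
  [BorelSpace G]

theorem rightTranslation_coeFn (μ : Measure G) [μ.IsMulRightInvariant] (s : G) (f : Lp ℂ 2 μ) :
    rightTranslation μ s f =ᵐ[μ] fun t => f (t * s) :=
  Lp.coeFn_compMeasurePreserving f (measurePreserving_mul_right μ s)

theorem rightTranslation_mul (μ : Measure G) [μ.IsMulRightInvariant] (s t : G) (f : Lp ℂ 2 μ) :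
    rightTranslation μ s (rightTranslation μ t f) = rightTranslation μ (s * t) f := by
  apply Lp.ext
  filter_upwards [rightTranslation_coeFn μ s (rightTranslation μ t f),
    rightTranslation_coeFn μ (s * t) f,
    (measurePreserving_mul_right μ s).quasiMeasurePreserving.ae (rightTranslation_coeFn μ t f)]
    with x h1 h2 h3
  rw [h1, h2, h3, mul_assoc]

theorem rightTranslation_one (μ : Measure G) [μ.IsMulRightInvariant] (f : Lp ℂ 2 μ) :
    rightTranslation μ 1 f = f := by
  apply Lp.ext
  filter_upwards [rightTranslation_coeFn μ 1 f] with x h1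
  rw [h1, mul_one]

/-- The right regular representation of `G` on `L²(G)`. -/
def rightRep (μ : Measure G) [μ.IsMulRightInvariant] : G →* (Lp ℂ 2 μ ≃ₗᵢ[ℂ] Lp ℂ 2 μ) where
  toFun s :=
    { toLinearEquiv := LinearEquiv.ofLinearMap (rightTranslation μ s).toLinearMap
        (rightTranslation μ s⁻¹).toLinearMap
        (by ext1 f; simpa [rightTranslation_mul] using rightTranslation_one μ f)
        (by ext1 f; simpa [rightTranslation_mul] using rightTranslation_one μ f)
      norm_map' := (rightTranslation μ s).norm_map }
  map_one' := by ext1 f; exact rightTranslation_one μ f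
  map_mul' s t := by ext1 f; exact (rightTranslation_mul μ s t f).symm

theorem rightRep_coeFn (μ : Measure G) [μ.IsMulRightInvariant] (s : G) (f : Lp ℂ 2 μ) :
    rightRep μ s f =ᵐ[μ] fun t => f (t * s) :=
  rightTranslation_coeFn μ s f

variable {V : Type*} [NormedAddCommGroup V] [InnerProductSpace ℂ V]
variable {W : Type*} [NormedAddCommGroup W] [InnerProductSpace ℂ W]

/-- The operator `T : L²(G) → V` has symbol `k` if `T u = ∫ u(s) π(s⁻¹) k ds` for continuous
compactly supported `u`. -/
def HasSymbol (μ : Measure G) (π : G →* (V ≃ₗᵢ[ℂ] V)) (T : Lp ℂ 2 μ →L[ℂ] V) (k : V) : Prop :=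
  ∀ u : G → ℂ, Continuous u → HasCompactSupport u →
    ∀ v : Lp ℂ 2 μ, v =ᵐ[μ] u → T v = ∫ s, u s • π s⁻¹ k ∂μ

/-- The strong continuity of a representation. -/
def StronglyContinuous (π : G →* (V ≃ₗᵢ[ℂ] V)) : Prop := ∀ x, Continuous fun s => π s x

theorem StronglyContinuous.integrable_smul {μ : Measure G} [IsFiniteMeasureOnCompacts μ]
    {π : G →* (V ≃ₗᵢ[ℂ] V)} (hπ : StronglyContinuous π)
    {u : G → ℂ} (hu : Continuous u) (hc : HasCompactSupport u) (k : V) :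
    Integrable (fun s => u s • π s⁻¹ k) μ :=
  (hu.smul ((hπ k).comp continuous_inv)).integrable_of_hasCompactSupport hc.smul_right

variable {μ : Measure G} {π : G →* (V ≃ₗᵢ[ℂ] V)} {ρ : G →* (W ≃ₗᵢ[ℂ] W)}

/-- A bounded operator passes through the integral. This is how finite dimension is transported
between representations. -/
theorem HasSymbol.comp [CompleteSpace V] [CompleteSpace W]
    [IsFiniteMeasureOnCompacts μ] (hπ : StronglyContinuous π)
    {T : Lp ℂ 2 μ →L[ℂ] V} {k : V} (hT : HasSymbol μ π T k) {C : V →L[ℂ] W}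
    (hC : Intertwines π ρ C) : HasSymbol μ ρ (C ∘L T) (C k) := fun u hu hc v hv => by
  rw [ContinuousLinearMap.comp_apply, hT u hu hc v hv,
    ← C.integral_comp_comm (hπ.integrable_smul hu hc k)]
  simp only [map_smul, hC _ k]

theorem HasSymbol.sub [IsFiniteMeasureOnCompacts μ] (hπ : StronglyContinuous π)
    {T T' : Lp ℂ 2 μ →L[ℂ] V} {k k' : V} (hT : HasSymbol μ π T k) (hT' : HasSymbol μ π T' k') :
    HasSymbol μ π (T - T') (k - k') := fun u hu hc v hv => by
  simp only [map_sub, smul_sub, sub_apply]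
  rw [integral_sub (hπ.integrable_smul hu hc k) (hπ.integrable_smul hu hc k'),
    ← hT u hu hc v hv, ← hT' u hu hc v hv]

/-- With `φ(s) = ⟪w, π(s⁻¹) w⟫` and a bump function `g` at `1`, testing on `u = g · conj φ` and
pairing with `w` gives `∫ g |φ|² = 0`, whereas `φ(1) = ‖w‖²`. -/
theorem HasSymbol.symbol_eq_zero [LocallyCompactSpace G] [CompleteSpace V]
    [μ.IsHaarMeasure] (hπ : StronglyContinuous π) {w : V} (hT : HasSymbol μ π 0 w) : w = 0 := by
  by_contra hw0
  obtain ⟨g, hgc, hg0, hg1⟩ := exists_continuous_nonneg_pos (1 : G)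
  obtain ⟨φ, hφ⟩ : ∃ φ : G → ℂ, ∀ s, φ s = ⟪w, π s⁻¹ w⟫_ℂ := ⟨_, fun _ => rfl⟩
  have hφc : Continuous φ := by
    rw [funext hφ]
    exact continuous_const.inner ((hπ w).comp continuous_inv)
  obtain ⟨u, hu⟩ : ∃ u : G → ℂ, ∀ s, u s = (g s : ℂ) * starRingEnd ℂ (φ s) := ⟨_, fun _ => rfl⟩
  have huc : Continuous u := by
    rw [funext hu]
    exact (Complex.continuous_ofReal.comp g.continuous).mul (Complex.continuous_conj.comp hφc)
  have hus : HasCompactSupport u := by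
    rw [funext hu]
    exact (hgc.comp_left (g := fun x : ℝ => (x : ℂ)) Complex.ofReal_zero).mul_right
  have h0 : ∫ s, u s • π s⁻¹ w ∂μ = 0 := by
    rw [← hT u huc hus ((huc.memLp_of_hasCompactSupport hus).toLp u) (MemLp.coeFn_toLp _)]
    simp
  have h1 : ∫ s, ((g s * ‖φ s‖ ^ 2 : ℝ) : ℂ) ∂μ = 0 := by
    have := integral_inner (𝕜 := ℂ) (hπ.integrable_smul (μ := μ) huc hus w) w
    rw [h0, inner_zero_right] at this
    rw [← this]
    refine integral_congr_ae (ae_of_all _ fun s => ?_)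
    simp only [inner_smul_right, hu, ← hφ, Complex.ofReal_mul, Complex.ofReal_pow,
      ← Complex.conj_mul', mul_assoc]
  rw [integral_complex_ofReal, Complex.ofReal_eq_zero] at h1
  have h2 : Continuous fun s => g s * ‖φ s‖ ^ 2 := g.continuous.mul (hφc.norm.pow 2)
  have h3 : HasCompactSupport fun s => g s * ‖φ s‖ ^ 2 := hgc.mul_right
  have h4 : (0 : G → ℝ) ≤ fun s => g s * ‖φ s‖ ^ 2 := fun s =>
    mul_nonneg (hg0 s) (sq_nonneg _)
  have h5 : φ 1 ≠ 0 := by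
    rw [hφ, inv_one, map_one]
    exact inner_self_ne_zero.2 hw0
  have h6 : g 1 * ‖φ 1‖ ^ 2 ≠ 0 := mul_ne_zero hg1 (pow_ne_zero 2 (norm_ne_zero_iff.2 h5))
  exact (h2.integral_pos_of_hasCompactSupport_nonneg_nonzero h3 h4 h6).ne' h1

theorem HasSymbol.unique [LocallyCompactSpace G] [CompleteSpace V]
    [μ.IsHaarMeasure] (hπ : StronglyContinuous π)
    {T : Lp ℂ 2 μ →L[ℂ] V} {k k' : V} (hT : HasSymbol μ π T k) (hT' : HasSymbol μ π T k') :
    k = k' := by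
  have := hT.sub hπ hT'
  rw [sub_self] at this
  exact sub_eq_zero.1 (this.symbol_eq_zero hπ)

end Symbols

theorem hasSymbol_zero {G : Type*} [Group G] [TopologicalSpace G] [MeasurableSpace G]
    {V : Type*} [NormedAddCommGroup V] [InnerProductSpace ℂ V] (μ : Measure G)
    (π : G →* (V ≃ₗᵢ[ℂ] V)) :
    HasSymbol μ π 0 0 := fun u _ _ v _ => by simp

/-! ### Convolution operators on a unimodular group -/

section Unimodular

variable {G : Type*} [Group G] [TopologicalSpace G] [IsTopologicalGroup G] [T2Space G]
  [SecondCountableTopology G] [LocallyCompactSpace G] [MeasurableSpace G] [BorelSpace G]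

theorem regular_of_isHaarMeasure (μ : Measure G) [μ.IsHaarMeasure] : μ.Regular := by
  let := TopologicalSpace.metrizableSpaceMetric G
  infer_instance

open Measure Function in
/-- A bi-invariant Haar measure is invariant under inversion. -/
theorem isInvInvariant_of_isMulRightInvariant (μ : Measure G) [μ.IsHaarMeasure]
    [μ.IsMulRightInvariant] : μ.IsInvInvariant := by
  have := regular_of_isHaarMeasure μ
  constructor
  have : μ.inv.IsHaarMeasure :=
    { toIsFiniteMeasureOnCompacts := inferInstance
      toIsOpenPosMeasure := inferInstance }
  -- Inversion multiplies `μ` by a constant `c`; inverting twice gives `c ^ 2 = 1`.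
  let c : ℝ≥0∞ := haarScalarFactor μ.inv μ
  have hc : μ.inv = c • μ := isMulLeftInvariant_eq_smul_of_regular μ.inv μ
  have : map Inv.inv (map Inv.inv μ) = c ^ 2 • μ := by
    rw [← inv_def μ, hc, Measure.map_smul, ← inv_def μ, hc, smul_smul, pow_two]
  have μeq : μ = c ^ 2 • μ := by
    rw [map_map continuous_inv.measurable continuous_inv.measurable] at this
    simpa only [inv_involutive, Involutive.comp_self, Measure.map_id]
  have K : TopologicalSpace.PositiveCompacts G := Classical.arbitrary _
  have : c ^ 2 * μ K = 1 ^ 2 * μ K := by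
    conv_rhs => rw [μeq]
    simp
  have : c ^ 2 = 1 ^ 2 :=
    (ENNReal.mul_left_inj (measure_pos_of_nonempty_interior _ K.interior_nonempty).ne'
          K.isCompact.measure_lt_top.ne).1 this
  have : c = 1 := (ENNReal.pow_right_strictMono two_ne_zero).injective this
  rw [hc, this, one_smul]

variable (μ : Measure G) [μ.IsHaarMeasure]

/-- The classes of continuous compactly supported functions are dense in `L²(G)`. -/
theorem denseRange_compactlySupported :
    DenseRange (Subtype.val : {v : Lp ℂ 2 μ //
      ∃ u : G → ℂ, Continuous u ∧ HasCompactSupport u ∧ v =ᵐ[μ] u} → Lp ℂ 2 μ) := by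
  have := regular_of_isHaarMeasure μ
  intro f
  rw [EMetric.mem_closure_iff]
  intro ε hε
  obtain ⟨δ, hδ0, hδ⟩ := exists_between hε
  obtain ⟨u, hus, hfu, huc, hu⟩ :=
    (Lp.memLp f).exists_hasCompactSupport_eLpNorm_sub_le (by simp) hδ0.ne'
  refine ⟨_, ⟨⟨hu.toLp u, u, huc, hus, hu.coeFn_toLp⟩, rfl⟩, lt_of_le_of_lt ?_ hδ⟩
  rw [Lp.edist_def]
  refine (eLpNorm_congr_ae ?_).trans_le hfu
  filter_upwards [hu.coeFn_toLp] with x hx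
  simp [hx]

variable [μ.IsMulRightInvariant]

theorem stronglyContinuous_rightRep : StronglyContinuous (rightRep μ) := fun f => by
  have := regular_of_isHaarMeasure μ
  let g : G → C(G, G) := fun s => ⟨fun t => t * s, continuous_mul_const s⟩
  have hg : Continuous g := ContinuousMap.continuous_of_continuous_uncurry g
    (continuous_snd.mul continuous_fst)
  exact (continuous_const (y := f)).compMeasurePreservingLp hg
    (fun s => measurePreserving_mul_right μ s) (by simp)

variable {μ}

section

variable {V : Type*} [NormedAddCommGroup V] [InnerProductSpace ℂ V]
variable {π : G →* (V ≃ₗᵢ[ℂ] V)}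

omit [μ.IsMulRightInvariant] in
theorem HasSymbol.eq_zero {T : Lp ℂ 2 μ →L[ℂ] V} (hT : HasSymbol μ π T 0) : T = 0 := by
  ext v
  refine (denseRange_compactlySupported μ).induction_on (p := fun v => T v = 0) v
    (isClosed_eq T.continuous continuous_const) ?_
  rintro ⟨v, u, hu, hc, hv⟩
  simp [hT u hu hc v hv]

/-- An operator with a symbol intertwines the right regular representation with `π`. -/
theorem HasSymbol.intertwines [CompleteSpace V] (hπ : StronglyContinuous π)
    {T : Lp ℂ 2 μ →L[ℂ] V} {k : V} (hT : HasSymbol μ π T k) : Intertwines (rightRep μ) π T := by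
  refine Intertwines.of_denseRange (denseRange_compactlySupported μ) ?_
  rintro r ⟨v, u, hu, hc, hv⟩
  have hv' : rightRep μ r v =ᵐ[μ] fun t => u (t * r) := by
    filter_upwards [rightRep_coeFn μ r v,
      (measurePreserving_mul_right μ r).quasiMeasurePreserving.ae hv] with t h1 h2
    rw [h1, h2]
  change T (rightRep μ r v) = π r (T v)
  rw [hT u hu hc v hv, hT _ (hu.comp (continuous_mul_const r))
    (hc.comp_homeomorph (Homeomorph.mulRight r)) _ hv']
  have h1 := ((π r).toContinuousLinearEquiv : V →L[ℂ] V).integral_comp_comm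
    (hπ.integrable_smul (μ := μ) hu hc k)
  refine Eq.trans ?_ h1
  -- The substitution `s ↦ s r` uses right invariance.
  rw [← integral_mul_right_eq_self (μ := μ)
    (fun s => ((π r).toContinuousLinearEquiv : V →L[ℂ] V) (u s • π s⁻¹ k)) r]
  congr 1 with s
  simp

end

variable (μ) in
omit [T2Space G] in
-- The integrability needed for Fubini on `G × E`. Since `f` is only square integrable, `|f| ≤ 1 +
-- |f|²` and `μ E < ∞` give the bound.
theorem integrable_convolution (f : Lp ℂ 2 μ) {u : G → ℂ} (hu : Continuous u)
    (hc : HasCompactSupport u) {E : Set G} (hE : μ E < ⊤) :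
    Integrable (fun p : G × G => u p.1 * f (p.2 * p.1⁻¹)) (μ.prod (μ.restrict E)) := by
  have hfm : Measurable f := (Lp.stronglyMeasurable f).measurable
  have hm : Measurable fun p : G × G => u p.1 * f (p.2 * p.1⁻¹) :=
    (hu.measurable.comp measurable_fst).mul
      (hfm.comp (measurable_snd.mul measurable_fst.inv))
  refine ⟨hm.aestronglyMeasurable, ?_⟩
  have hui : ∫⁻ s, ‖u s‖ₑ ∂μ < ⊤ := (hu.integrable_of_hasCompactSupport hc).2
  have hf2 : ∫⁻ t, ‖f t‖ₑ ^ 2 ∂μ < ⊤ := by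
    have := lintegral_rpow_enorm_lt_top_of_eLpNorm_lt_top (p := 2) (by simp) (by simp)
      (Lp.memLp f).2
    simpa using this
  rw [HasFiniteIntegral, lintegral_prod _ hm.enorm.aemeasurable]
  have hb : ∀ s, ∫⁻ t in E, ‖u s * f (t * s⁻¹)‖ₑ ∂μ ≤
      ‖u s‖ₑ * (μ E + ∫⁻ t, ‖f t‖ₑ ^ 2 ∂μ) := by
    intro s
    simp only [enorm_mul]
    rw [lintegral_const_mul _ (by fun_prop)]
    gcongr
    calc ∫⁻ t in E, ‖f (t * s⁻¹)‖ₑ ∂μ ≤ ∫⁻ t in E, (1 + ‖f (t * s⁻¹)‖ₑ ^ 2) ∂μ := by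
          refine lintegral_mono fun t => ?_
          rcases le_total ‖f (t * s⁻¹)‖ₑ 1 with h | h
          · exact h.trans le_self_add
          · exact (le_self_pow₀ h two_ne_zero).trans le_add_self
      _ = μ E + ∫⁻ t in E, ‖f (t * s⁻¹)‖ₑ ^ 2 ∂μ := by
          rw [lintegral_add_left measurable_const]; simp
      _ ≤ μ E + ∫⁻ t, ‖f (t * s⁻¹)‖ₑ ^ 2 ∂μ := by
          gcongr; exact Measure.restrict_le_self
      _ = _ := by rw [lintegral_mul_right_eq_self (fun t => ‖f t‖ₑ ^ 2) s⁻¹]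
  refine (lintegral_mono hb).trans_lt ?_
  rw [lintegral_mul_const _ hu.measurable.enorm]
  exact ENNReal.mul_lt_top hui (ENNReal.add_lt_top.2 ⟨hE, hf2⟩)

/-- The vector valued integral `∫ u(s) R_{s⁻¹} f ds` is the convolution `f * u`. -/
theorem coeFn_integral_smul_rightRep (f : Lp ℂ 2 μ) {u : G → ℂ} (hu : Continuous u)
    (hc : HasCompactSupport u) :
    (∫ s, u s • rightRep μ s⁻¹ f ∂μ : Lp ℂ 2 μ) =ᵐ[μ] fun t => ∫ s, f s * u (s⁻¹ * t) ∂μ := by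
  have := isInvInvariant_of_isMulRightInvariant μ
  -- Substituting `s ↦ t s⁻¹` requires invariance of `μ` under inversion, hence unimodularity.
  have hsub : ∀ t, ∫ s, f s * u (s⁻¹ * t) ∂μ = ∫ s, u s * f (t * s⁻¹) ∂μ := by
    intro t
    rw [← integral_div_left_eq_self (fun s => f s * u (s⁻¹ * t)) μ t]
    congr 1 with s
    simp [div_eq_mul_inv, mul_comm]
  simp only [hsub]
  -- The `L²`-valued integral is compared with the pointwise one by pairing with indicators of sets
  -- of finite measure and using Fubini.
  refine ae_eq_of_forall_setIntegral_eq_of_sigmaFinite ?_ ?_ ?_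
  · intro E hE hμE
    have : IsFiniteMeasure (μ.restrict E) := ⟨by simpa using hμE⟩
    exact ((Lp.memLp _).restrict E).integrable (by norm_num)
  · intro E hE hμE
    exact (integrable_convolution μ f hu hc hμE).integral_prod_right
  · intro E hE hμE
    rw [← L2.inner_indicatorConstLp_one hE hμE.ne,
      ← integral_inner ((stronglyContinuous_rightRep μ).integrable_smul hu hc f),
      ← integral_integral_swap (integrable_convolution μ f hu hc hμE)]
    congr 1 with s
    rw [L2.inner_indicatorConstLp_one]
    refine integral_congr_ae (ae_restrict_of_ae ?_)
    filter_upwards [Lp.coeFn_smul (u s) (rightRep μ s⁻¹ f), rightRep_coeFn μ s⁻¹ f] with t h1 h2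
    rw [h1, Pi.smul_apply, h2, smul_eq_mul]

/-- `B = L_f` if and only if `B` has symbol `f`. -/
theorem isLeftConvolution_iff_hasSymbol (f : Lp ℂ 2 μ) (B : Lp ℂ 2 μ →L[ℂ] Lp ℂ 2 μ) :
    IsLeftConvolution μ f B ↔ HasSymbol μ (rightRep μ) B f := by
  refine ⟨fun h u hu hc v hv => ?_, fun h u hu hc v hv => ?_⟩
  · exact Lp.ext ((h u hu hc v hv).trans (coeFn_integral_smul_rightRep f hu hc).symm)
  · rw [h u hu hc v hv]
    exact coeFn_integral_smul_rightRep f hu hc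

/-! ### The trace in terms of symbols -/

section Trace

variable {V : Type*} [NormedAddCommGroup V] [InnerProductSpace ℂ V] [CompleteSpace V]
variable {W : Type*} [NormedAddCommGroup W] [InnerProductSpace ℂ W] [CompleteSpace W]
variable {π : G →* (V ≃ₗᵢ[ℂ] V)} {ρ : G →* (W ≃ₗᵢ[ℂ] W)}

/-- An intertwiner dominated by an operator with a symbol has a symbol, of smaller norm. -/
theorem HasSymbol.exists_of_norm_le (hπ : StronglyContinuous π)
    {T : Lp ℂ 2 μ →L[ℂ] V} {k : V} (hT : HasSymbol μ π T k)
    {S : Lp ℂ 2 μ →L[ℂ] W} (hS : Intertwines (rightRep μ) ρ S) (h : ∀ v, ‖S v‖ ≤ ‖T v‖) :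
    ∃ k', HasSymbol μ ρ S k' ∧ ‖k'‖ ≤ ‖k‖ := by
  obtain ⟨R, hR, hRT, hRn⟩ := exists_intertwines_comp_eq (hT.intertwines hπ) hS h
  refine ⟨R k, ?_, hRn k⟩
  have : R ∘L T = S := by ext1 v; exact hRT v
  rw [← this]
  exact hT.comp hπ hR

theorem norm_eq_of_adjoint_comp_self_eq {X : Type*} [NormedAddCommGroup X]
    [InnerProductSpace ℂ X] [CompleteSpace X] {T : X →L[ℂ] V} {S : X →L[ℂ] W}
    (h : S.adjoint ∘L S = T.adjoint ∘L T) (x : X) : ‖S x‖ = ‖T x‖ := by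
  rw [ContinuousLinearMap.apply_norm_eq_sqrt_inner_adjoint_left, h,
    ← ContinuousLinearMap.apply_norm_eq_sqrt_inner_adjoint_left]

/-- If `L_f* L_f = T* T`, then `‖T v‖ = ‖L_f v‖`, so `T = R L_f` for an equivariant contraction `R`,
and `R f` is a symbol of norm at most `‖f‖`. Uniqueness of symbols lets one `k` be compared with
every `f` in the infimum. -/
theorem exists_hasSymbol_of_trG_lt_top {T : Lp ℂ 2 μ →L[ℂ] V} (hT : Intertwines (rightRep μ) π T)
    (hπ : StronglyContinuous π) (h : trG μ (T.adjoint ∘L T) < ⊤) :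
    ∃ k, HasSymbol μ π T k ∧ ‖k‖ₑ ^ 2 ≤ trG μ (T.adjoint ∘L T) := by
  have key : ∀ (f : Lp ℂ 2 μ) (B : Lp ℂ 2 μ →L[ℂ] Lp ℂ 2 μ),
      IsLeftConvolution μ f B ∧ B.adjoint ∘L B = T.adjoint ∘L T →
      ∃ k, HasSymbol μ π T k ∧ ‖k‖ ≤ ‖f‖ := fun f B hB =>
    HasSymbol.exists_of_norm_le (stronglyContinuous_rightRep μ)
      ((isLeftConvolution_iff_hasSymbol f B).1 hB.1) hT
      fun v => (norm_eq_of_adjoint_comp_self_eq hB.2 v).ge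
  obtain ⟨f, B, hB, -⟩ : ∃ (f : Lp ℂ 2 μ) (B : Lp ℂ 2 μ →L[ℂ] Lp ℂ 2 μ)
      (_ : IsLeftConvolution μ f B ∧ B.adjoint ∘L B = T.adjoint ∘L T),
      ∫⁻ s, ‖f s‖ₑ ^ 2 ∂μ < ⊤ := by simpa only [trG, iInf_lt_iff] using h
  obtain ⟨k, hk, -⟩ := key f B hB
  refine ⟨k, hk, le_iInf fun f' => le_iInf fun B' => le_iInf fun hB' => ?_⟩
  obtain ⟨k', hk', hn⟩ := key f' B' hB'
  rw [hk.unique hπ hk', lintegral_enorm_sq_eq]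
  gcongr
  exact enorm_le_iff_norm_le.2 hn

/-- `T` may take values in any `V`, so it is replaced by `|T|`, which acts on `L²(G)`, satisfies
`|T|* |T| = T* T` and inherits a symbol from `T`; thus `|T|` is a convolution operator. -/
theorem HasSymbol.trG_le (hπ : StronglyContinuous π) {T : Lp ℂ 2 μ →L[ℂ] V} {k : V}
    (hT : HasSymbol μ π T k) : trG μ (T.adjoint ∘L T) ≤ ‖k‖ₑ ^ 2 := by
  have hi := hT.intertwines hπ
  obtain ⟨D, hD, hDa, hDD⟩ := (hi.adjoint.comp hi).exists_sqrt
    (by rw [ContinuousLinearMap.nonneg_iff_isPositive]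
        exact ContinuousLinearMap.isPositive_adjoint_comp_self T)
  have hD2 : D.adjoint ∘L D = T.adjoint ∘L T := by rw [hDa, hDD]
  obtain ⟨f, hf, hn⟩ := hT.exists_of_norm_le hπ hD
    fun v => (norm_eq_of_adjoint_comp_self_eq hD2 v).le
  refine (iInf_le_of_le f (iInf_le_of_le D (iInf_le_of_le
    ⟨(isLeftConvolution_iff_hasSymbol f D).2 hf, hD2⟩ le_rfl))).trans ?_
  rw [lintegral_enorm_sq_eq]
  gcongr
  exact enorm_le_iff_norm_le.2 hn

end Trace

end Unimodular

end GFredholm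
end

/-! ### Representations of finite `G`-dimension -/

noncomputable section

namespace GFredholm

theorem tsum_enorm_sq_comp_lt_top {V W : Type*} [NormedAddCommGroup V]
    [InnerProductSpace ℂ V] [NormedAddCommGroup W] [InnerProductSpace ℂ W] {ι : Type*}
    {k : ι → V} (hk : ∑' i, ‖k i‖ₑ ^ 2 < ⊤)
    (C : V →L[ℂ] W) : ∑' i, ‖C (k i)‖ₑ ^ 2 < ⊤ := by
  refine lt_of_le_of_lt (ENNReal.tsum_le_tsum (g := fun i => ‖C‖ₑ ^ 2 * ‖k i‖ₑ ^ 2) fun i => ?_) ?_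
  · rw [← mul_pow]
    gcongr
    exact C.le_opENorm _
  · rw [ENNReal.tsum_mul_left]
    exact ENNReal.mul_lt_top (by simp) hk

section FiniteDimension

variable {G : Type*} [Group G] [TopologicalSpace G] [IsTopologicalGroup G] [MeasurableSpace G]
  [BorelSpace G]

/-- Finiteness of the `G`-dimension of a unitary representation, independently of an ambient
module: `V` is the range of an equivariant coisometry `⨁_i L²(G) → V` whose components have square
summable symbols. -/
def FiniteGDim (μ : Measure G) {V : Type*} [NormedAddCommGroup V]
    [InnerProductSpace ℂ V] [CompleteSpace V] (π : G →* (V ≃ₗᵢ[ℂ] V)) : Prop :=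
  ∃ (ι : Type) (T : ι → Lp ℂ 2 μ →L[ℂ] V) (k : ι → V), (∀ i, HasSymbol μ π (T i) (k i)) ∧
    ∑' i, ‖k i‖ₑ ^ 2 < ⊤ ∧ ∀ x, HasSum (fun i => ‖(T i).adjoint x‖ ^ 2) (‖x‖ ^ 2)

variable {μ : Measure G}
variable {V : Type*} [NormedAddCommGroup V] [InnerProductSpace ℂ V] [CompleteSpace V]
variable {W₁ : Type*} [NormedAddCommGroup W₁] [InnerProductSpace ℂ W₁] [CompleteSpace W₁]
variable {W₂ : Type*} [NormedAddCommGroup W₂] [InnerProductSpace ℂ W₂] [CompleteSpace W₂]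
variable {π : G →* (V ≃ₗᵢ[ℂ] V)} {ρ₁ : G →* (W₁ ≃ₗᵢ[ℂ] W₁)} {ρ₂ : G →* (W₂ ≃ₗᵢ[ℂ] W₂)}

/-- If two intertwiners into representations of finite `G`-dimension satisfy
`‖W₁ x‖² + ‖W₂ x‖² = ‖x‖²`, then the source has finite `G`-dimension. -/
theorem FiniteGDim.of_isometric_pair [IsFiniteMeasureOnCompacts μ]
    (hsc₁ : StronglyContinuous ρ₁) (hsc₂ : StronglyContinuous ρ₂)
    (h₁ : FiniteGDim μ ρ₁) (h₂ : FiniteGDim μ ρ₂) {C₁ : V →L[ℂ] W₁} {C₂ : V →L[ℂ] W₂}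
    (hC₁ : Intertwines π ρ₁ C₁) (hC₂ : Intertwines π ρ₂ C₂)
    (h : ∀ x, ‖C₁ x‖ ^ 2 + ‖C₂ x‖ ^ 2 = ‖x‖ ^ 2) : FiniteGDim μ π := by
  obtain ⟨ι₁, T₁, k₁, hT₁, hk₁, hs₁⟩ := h₁
  obtain ⟨ι₂, T₂, k₂, hT₂, hk₂, hs₂⟩ := h₂
  refine ⟨ι₁ ⊕ ι₂, Sum.elim (fun i => C₁.adjoint ∘L T₁ i) (fun i => C₂.adjoint ∘L T₂ i),
    Sum.elim (fun i => C₁.adjoint (k₁ i)) (fun i => C₂.adjoint (k₂ i)), ?_, ?_, ?_⟩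
  · rintro (i | i)
    · exact (hT₁ i).comp hsc₁ hC₁.adjoint
    · exact (hT₂ i).comp hsc₂ hC₂.adjoint
  · rw [ENNReal.summable.tsum_sum ENNReal.summable]
    exact ENNReal.add_lt_top.2
      ⟨tsum_enorm_sq_comp_lt_top hk₁ _, tsum_enorm_sq_comp_lt_top hk₂ _⟩
  · intro x
    rw [← h x]
    refine HasSum.sum ?_ ?_
    · simpa [Function.comp_def, ContinuousLinearMap.adjoint_comp] using hs₁ (C₁ x)
    · simpa [Function.comp_def, ContinuousLinearMap.adjoint_comp] using hs₂ (C₂ x)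

/-- If two intertwiners into representations of finite `G`-dimension are jointly injective, then
the source has finite `G`-dimension. -/
theorem FiniteGDim.of_injective_pair [IsFiniteMeasureOnCompacts μ]
    (hsc₁ : StronglyContinuous ρ₁) (hsc₂ : StronglyContinuous ρ₂)
    (h₁ : FiniteGDim μ ρ₁) (h₂ : FiniteGDim μ ρ₂) {C₁ : V →L[ℂ] W₁} {C₂ : V →L[ℂ] W₂}
    (hC₁ : Intertwines π ρ₁ C₁) (hC₂ : Intertwines π ρ₂ C₂)
    (h : ∀ x, C₁ x = 0 → C₂ x = 0 → x = 0) : FiniteGDim μ π := by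
  have hi : Intertwines π π (C₁.adjoint ∘L C₁ + C₂.adjoint ∘L C₂) := fun s x => by
    have e₁ := hC₁.adjoint.comp hC₁ s x
    have e₂ := hC₂.adjoint.comp hC₂ s x
    rw [add_apply, add_apply, e₁, e₂, map_add]
  -- Polar decomposition of `x ↦ (C₁ x, C₂ x)`: `D` is its absolute value, injective and
  -- self-adjoint, so of dense range. The isometric part has components `R₁`, `R₂` with `Rᵢ D = Cᵢ`.
  obtain ⟨D, hD, hDa, hDD⟩ := hi.exists_sqrt (by
    rw [ContinuousLinearMap.nonneg_iff_isPositive]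
    exact (ContinuousLinearMap.isPositive_adjoint_comp_self C₁).add
      (ContinuousLinearMap.isPositive_adjoint_comp_self C₂))
  have hnorm : ∀ x, ‖C₁ x‖ ^ 2 + ‖C₂ x‖ ^ 2 = ‖D x‖ ^ 2 := fun x => by
    rw [ContinuousLinearMap.apply_norm_sq_eq_inner_adjoint_left D, hDa, hDD,
      ContinuousLinearMap.apply_norm_sq_eq_inner_adjoint_left C₁,
      ContinuousLinearMap.apply_norm_sq_eq_inner_adjoint_left C₂, add_apply, inner_add_left,
      map_add]
  have hdense : DenseRange D := by
    have h0 : D.rangeᗮ = ⊥ := by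
      rw [ContinuousLinearMap.orthogonal_range, hDa, LinearMap.ker_eq_bot']
      intro x hx
      have h2 : ‖C₁ x‖ ^ 2 + ‖C₂ x‖ ^ 2 = 0 := by
        rw [hnorm x, show D x = 0 from hx]; simp
      have h3 := sq_nonneg ‖C₁ x‖
      have h4 := sq_nonneg ‖C₂ x‖
      refine h x ?_ ?_
      · exact norm_eq_zero.1 (pow_eq_zero_iff two_ne_zero |>.1 (by linarith))
      · exact norm_eq_zero.1 (pow_eq_zero_iff two_ne_zero |>.1 (by linarith))
    have := Submodule.topologicalClosure_eq_top_iff.2 h0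
    exact Submodule.dense_iff_topologicalClosure_eq_top.2 this
  obtain ⟨R₁, hR₁, e₁, -⟩ := exists_intertwines_comp_eq hD hC₁ fun x =>
    abs_le_of_sq_le_sq' (by linarith [hnorm x, sq_nonneg ‖C₂ x‖]) (norm_nonneg _) |>.2
  obtain ⟨R₂, hR₂, e₂, -⟩ := exists_intertwines_comp_eq hD hC₂ fun x =>
    abs_le_of_sq_le_sq' (by linarith [hnorm x, sq_nonneg ‖C₁ x‖]) (norm_nonneg _) |>.2
  refine FiniteGDim.of_isometric_pair hsc₁ hsc₂ h₁ h₂ hR₁ hR₂ fun y => ?_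
  refine hdense.induction_on (p := fun y => ‖R₁ y‖ ^ 2 + ‖R₂ y‖ ^ 2 = ‖y‖ ^ 2) y
    (isClosed_eq (by fun_prop) (by fun_prop)) fun x => ?_
  rw [e₁, e₂, hnorm]

theorem FiniteGDim.of_injective [IsFiniteMeasureOnCompacts μ]
    (hsc : StronglyContinuous ρ₁) (h₁ : FiniteGDim μ ρ₁) {C : V →L[ℂ] W₁}
    (hC : Intertwines π ρ₁ C) (h : ∀ x, C x = 0 → x = 0) : FiniteGDim μ π :=
  FiniteGDim.of_injective_pair hsc hsc h₁ h₁ hC hC fun x hx _ => h x hx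

end FiniteDimension

/-! ### Isometries into free modules and their range projections -/

section FreeModule

variable {G : Type*} [MeasurableSpace G] {μ : Measure G}
variable {V : Type*} [NormedAddCommGroup V] [InnerProductSpace ℂ V] {ι : Type*}

/-- The coordinates of an isometry into a free module. -/
def coordinate (J : V →ₗᵢ[ℂ] FreeModule μ ι) (i : ι) : V →L[ℂ] Lp ℂ 2 μ :=
  lp.evalCLM ℂ (fun _ : ι => Lp ℂ 2 μ) 2 i ∘L J.toContinuousLinearMap

theorem coordinate_apply (J : V →ₗᵢ[ℂ] FreeModule μ ι) (i : ι) (x : V) :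
    coordinate J i x = (J x : ι → Lp ℂ 2 μ) i := rfl

theorem hasSum_coordinate (J : V →ₗᵢ[ℂ] FreeModule μ ι) (x : V) :
    HasSum (fun i => ‖coordinate J i x‖ ^ 2) (‖x‖ ^ 2) := by
  have := lp.hasSum_norm (p := 2) (by simp) (J x)
  simpa [coordinate_apply] using this

/-- The isometry into a free module with prescribed coordinates. -/
theorem exists_coordinate_eq (c : ι → V →L[ℂ] Lp ℂ 2 μ)
    (hc : ∀ x, HasSum (fun i => ‖c i x‖ ^ 2) (‖x‖ ^ 2)) :
    ∃ J : V →ₗᵢ[ℂ] FreeModule μ ι, ∀ i, coordinate J i = c i := by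
  have hmem : ∀ x, Memℓp (fun i => c i x) 2 := fun x =>
    memℓp_gen (by simpa using (hc x).summable)
  let J₀ : V →ₗ[ℂ] FreeModule μ ι :=
    { toFun := fun x => ⟨fun i => c i x, hmem x⟩
      map_add' := fun x y => by ext1; funext i; exact map_add (c i) x y
      map_smul' := fun a x => by ext1; funext i; exact map_smul (c i) a x }
  refine ⟨⟨J₀, fun x => ?_⟩, fun i => rfl⟩
  have h1 := lp.hasSum_norm (p := 2) (by simp) (J₀ x)
  have h2 : ‖J₀ x‖ ^ 2 = ‖x‖ ^ 2 := by
    simp only [ENNReal.toReal_ofNat, Real.rpow_ofNat] at h1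
    exact h1.unique (hc x)
  exact (pow_left_inj₀ (norm_nonneg _) (norm_nonneg _) two_ne_zero).1 h2

theorem starProjection_of_range [CompleteSpace V] (J : V →ₗᵢ[ℂ] FreeModule μ ι)
    (K : Submodule ℂ (FreeModule μ ι)) (hK : ∀ y, y ∈ K ↔ ∃ x, J x = y) :
    K.topologicalClosure.starProjection =
      J.toContinuousLinearMap ∘L J.toContinuousLinearMap.adjoint := by
  ext1 y
  refine Submodule.eq_starProjection_of_mem_of_inner_eq_zero
    (Submodule.le_topologicalClosure _ ((hK _).2 ⟨_, rfl⟩)) ?_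
  have hK' : K.topologicalClosure = K := by
    refine IsClosed.submodule_topologicalClosure_eq ?_
    have : (K : Set (FreeModule μ ι)) = Set.range J := Set.ext hK
    rw [this]
    exact J.isometry.isClosedEmbedding.isClosed_range
  intro w hw
  rw [hK', hK] at hw
  obtain ⟨x, rfl⟩ := hw
  rw [inner_sub_left, sub_eq_zero]
  exact (ContinuousLinearMap.adjoint_inner_left J.toContinuousLinearMap x y).symm.trans
    (J.inner_map_map _ _).symm

theorem adjoint_evalCLM [DecidableEq ι] (i : ι) :
    (lp.evalCLM ℂ (fun _ : ι => Lp ℂ 2 μ) 2 i).adjoint =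
      lp.singleContinuousLinearMap ℂ (fun _ : ι => Lp ℂ 2 μ) 2 i := by
  symm
  rw [ContinuousLinearMap.eq_adjoint_iff]
  intro a f
  exact lp.inner_single_left (𝕜 := ℂ) (G := fun _ : ι => Lp ℂ 2 μ) i a f

/-- The diagonal entries of the projection onto the range of an isometry. -/
theorem diagEntry_starProjection [CompleteSpace V] [DecidableEq ι] (J : V →ₗᵢ[ℂ] FreeModule μ ι)
    (K : Submodule ℂ (FreeModule μ ι)) (hK : ∀ y, y ∈ K ↔ ∃ x, J x = y) (i : ι) :
    diagEntry μ K.topologicalClosure.starProjection i =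
      coordinate J i ∘L (coordinate J i).adjoint := by
  rw [diagEntry, starProjection_of_range J K hK, coordinate, ContinuousLinearMap.adjoint_comp,
    adjoint_evalCLM]
  rfl

open Classical in
theorem TrG_starProjection [Group G] [TopologicalSpace G] [CompleteSpace V]
    (J : V →ₗᵢ[ℂ] FreeModule μ ι)
    (K : Submodule ℂ (FreeModule μ ι)) (hK : ∀ y, y ∈ K ↔ ∃ x, J x = y) :
    TrG μ K.topologicalClosure.starProjection =
      ∑' i, trG μ (coordinate J i ∘L (coordinate J i).adjoint) :=
  tsum_congr fun i => congrArg (trG μ) (diagEntry_starProjection J K hK i)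

end FreeModule

/-! ### Finite `dim_G` is the same as `FiniteGDim` -/

section Dimension

universe u v

variable {G : Type v} [Group G] [TopologicalSpace G] [IsTopologicalGroup G] [MeasurableSpace G]
  [BorelSpace G] {μ : Measure G} [μ.IsMulRightInvariant]
variable {V : Type u} [NormedAddCommGroup V] [InnerProductSpace ℂ V] [CompleteSpace V]

theorem HilbertGModule.stronglyContinuous_subRep (M : HilbertGModule μ V) (L : M.ClosedInvariant) :
    StronglyContinuous (M.subRep L) := (M.restrict L).continuous_rep

theorem intertwines_subtypeL (M : HilbertGModule μ V) (L : M.ClosedInvariant) :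
    Intertwines (M.subRep L) M.rep L.carrier.subtypeL := fun _ _ => rfl

theorem intertwines_orthogonalProjectionOnto (M : HilbertGModule μ V) (L : M.ClosedInvariant) :
    Intertwines M.rep (M.subRep L) L.carrier.orthogonalProjectionOnto := by
  rw [← Submodule.adjoint_subtypeL]
  exact (intertwines_subtypeL M L).adjoint

variable [T2Space G] [SecondCountableTopology G] [LocallyCompactSpace G] [μ.IsHaarMeasure]

/-- A closed invariant subspace with `dim_G L < ∞` is a representation of finite
`G`-dimension. -/
theorem finiteGDim_of_dim_lt_top (M : HilbertGModule μ V) (L : M.ClosedInvariant)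
    (h : M.dim L.carrier < ⊤) : FiniteGDim μ (M.subRep L) := by
  obtain ⟨ι, J, hJ, htr⟩ : ∃ (ι : Type u) (J : V →ₗᵢ[ℂ] FreeModule μ ι)
      (_ : IsEquivariantEmbedding μ M.rep J),
      TrG μ (L.carrier.map J.toLinearMap).topologicalClosure.starProjection < ⊤ := by
    simpa only [HilbertGModule.dim, iInf_lt_iff] using h
  let J₀ : L.carrier →ₗᵢ[ℂ] FreeModule μ ι := J.comp L.carrier.subtypeₗᵢ
  have hK : ∀ y, y ∈ L.carrier.map J.toLinearMap ↔ ∃ x, J₀ x = y := fun y =>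
    ⟨fun ⟨x, hx, e⟩ => ⟨⟨x, hx⟩, e⟩, fun ⟨x, e⟩ => ⟨x, x.2, e⟩⟩
  have hcoord : ∀ i, Intertwines (M.subRep L) (rightRep μ) (coordinate J₀ i) :=
    fun i s x => hJ s x i
  let T : ι → Lp ℂ 2 μ →L[ℂ] L.carrier := fun i => (coordinate J₀ i).adjoint
  have htr' : ∑' i, trG μ ((T i).adjoint ∘L T i) < ⊤ := by
    rw [TrG_starProjection J₀ _ hK] at htr
    simpa only [T, ContinuousLinearMap.adjoint_adjoint] using htr
  have hsc := M.stronglyContinuous_subRep L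
  choose k hk hle using fun i => exists_hasSymbol_of_trG_lt_top (T := T i) (hcoord i).adjoint hsc
    ((ENNReal.le_tsum i).trans_lt htr')
  have hksum : ∑' i, ‖k i‖ₑ ^ 2 < ⊤ := (ENNReal.tsum_le_tsum hle).trans_lt htr'
  -- Only countably many symbols are nonzero, and an operator with symbol `0` vanishes. Discarding
  -- the others permits an index set in `Type`, whatever the universe of the module.
  have hcount : (Function.support fun i => ‖k i‖ₑ ^ 2).Countable :=
    Summable.countable_support_ennreal hksum.ne
  set s := Function.support fun i => ‖k i‖ₑ ^ 2 with hs
  have : Countable s := hcount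
  let e : Shrink.{0} s ≃ s := (equivShrink.{0} s).symm
  refine ⟨Shrink.{0} s, fun j => T (e j), fun j => k (e j), fun j => hk _, ?_, fun x => ?_⟩
  · exact (ENNReal.tsum_comp_le_tsum_of_injective
      (Subtype.val_injective.comp e.injective) (fun i => ‖k i‖ₑ ^ 2)).trans_lt hksum
  · have h1 : HasSum (fun i => ‖(T i).adjoint x‖ ^ 2) (‖x‖ ^ 2) := by
      simpa only [T, ContinuousLinearMap.adjoint_adjoint] using hasSum_coordinate J₀ x
    have hsupp : (Function.support fun i => ‖(T i).adjoint x‖ ^ 2) ⊆ s := by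
      intro i hi hki
      have hk0 : k i = 0 := by simpa using hki
      have := hk i
      rw [hk0] at this
      exact hi (by simp [this.eq_zero])
    rw [← hasSum_subtype_iff_of_support_subset hsupp, ← e.hasSum_iff] at h1
    exact h1

theorem trG_zero : trG μ (0 : Lp ℂ 2 μ →L[ℂ] Lp ℂ 2 μ) = 0 := by
  have := (hasSymbol_zero μ (rightRep μ)).trG_le (stronglyContinuous_rightRep μ)
  simpa using this

/-- A closed invariant subspace which is a representation of finite `G`-dimension satisfies
`dim_G L < ∞`. -/
theorem dim_lt_top_of_finiteGDim (M : HilbertGModule μ V) (L : M.ClosedInvariant)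
    (h : FiniteGDim μ (M.subRep L)) : M.dim L.carrier < ⊤ := by
  obtain ⟨ι, T, k, hT, hk, hs⟩ := h
  obtain ⟨ι', J, hJ⟩ := M.projective
  have hsc := M.stronglyContinuous_subRep L
  let P : V →L[ℂ] L.carrier := L.carrier.orthogonalProjectionOnto
  have hP : Intertwines M.rep (M.subRep L) P := intertwines_orthogonalProjectionOnto M L
  have hPL : ∀ x : L.carrier, P x = x :=
    Submodule.orthogonalProjectionOnto_mem_subspace_eq_self
  let P' : V →L[ℂ] V := 1 - L.carrier.subtypeL ∘L P
  have hP' : Intertwines M.rep M.rep P' := fun s x => by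
    simp only [P', sub_apply, map_sub]
    rw [((intertwines_subtypeL M L).comp hP) s x]
    rfl
  -- A new embedding of the whole module: the coisometry's adjoint on `L`, the given `J` on `Lᗮ`. As
  -- `dim` is an infimum over embeddings, this one suffices.
  let c : ULift.{u} ι ⊕ ι' → V →L[ℂ] Lp ℂ 2 μ :=
    Sum.elim (fun i => (T i.down).adjoint ∘L P) (fun j => coordinate J j ∘L P')
  have hc : ∀ x, HasSum (fun i => ‖c i x‖ ^ 2) (‖x‖ ^ 2) := by
    intro x
    have hx : ‖x‖ ^ 2 = ‖P x‖ ^ 2 + ‖P' x‖ ^ 2 := by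
      have := Submodule.norm_sq_eq_add_norm_sq_starProjection x L.carrier
      rw [this]
      congr 3
      simp [P', P]
    rw [hx]
    refine HasSum.sum ?_ (hasSum_coordinate J (P' x))
    exact (Equiv.ulift.{u}.hasSum_iff (f := fun i => ‖(T i).adjoint (P x)‖ ^ 2)).2 (hs (P x))
  obtain ⟨J', hJ'⟩ := exists_coordinate_eq c hc
  have hequiv : IsEquivariantEmbedding μ M.rep J' := by
    intro s x i
    rw [← coordinate_apply, ← coordinate_apply, hJ' i]
    rcases i with i | j
    · exact ((hT i.down).intertwines hsc).adjoint.comp hP s x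
    · exact Intertwines.comp (ρ := M.rep) (σ := rightRep μ) (fun s x => hJ s x j) hP' s x
  let J₀ : L.carrier →ₗᵢ[ℂ] FreeModule μ (ULift.{u} ι ⊕ ι') := J'.comp L.carrier.subtypeₗᵢ
  have hK : ∀ y, y ∈ L.carrier.map J'.toLinearMap ↔ ∃ x, J₀ x = y := fun y =>
    ⟨fun ⟨x, hx, e⟩ => ⟨⟨x, hx⟩, e⟩, fun ⟨x, e⟩ => ⟨x, x.2, e⟩⟩
  have hJ₀ : ∀ i, coordinate J₀ i = c i ∘L L.carrier.subtypeL := fun i => by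
    rw [← hJ' i]; rfl
  have hinl : ∀ i, coordinate J₀ (Sum.inl i) = (T i.down).adjoint := fun i => by
    rw [hJ₀]; ext1 x
    change (T i.down).adjoint (P x) = _
    rw [hPL]
  have hinr : ∀ j, coordinate J₀ (Sum.inr j) = 0 := fun j => by
    rw [hJ₀]; ext1 x
    change coordinate J j (x - (P x : V)) = 0
    rw [hPL, sub_self, map_zero]
  simp only [HilbertGModule.dim, iInf_lt_iff]
  refine ⟨_, J', hequiv, ?_⟩
  rw [TrG_starProjection J₀ _ hK, ENNReal.summable.tsum_sum ENNReal.summable]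
  refine ENNReal.add_lt_top.2 ⟨?_, ?_⟩
  · refine lt_of_le_of_lt (ENNReal.tsum_le_tsum (g := fun i => ‖k i.down‖ₑ ^ 2) fun i => ?_) ?_
    · rw [hinl, ContinuousLinearMap.adjoint_adjoint]
      exact (hT i.down).trG_le hsc
    · exact (Equiv.ulift.{u}.tsum_eq fun i => ‖k i‖ₑ ^ 2).trans_lt hk
  · refine lt_of_eq_of_lt (ENNReal.tsum_eq_zero.2 fun j => ?_) ENNReal.zero_lt_top
    rw [hinr, ContinuousLinearMap.zero_comp, trG_zero]

end Dimension

end GFredholm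
end

/-! ### Graph projections, spectral cut-offs and the open mapping theorem -/

noncomputable section

namespace GFredholm

section HilbertSpace

variable {H₁ : Type*} [NormedAddCommGroup H₁] [InnerProductSpace ℂ H₁] [CompleteSpace H₁]
variable {H₂ : Type*} [NormedAddCommGroup H₂] [InnerProductSpace ℂ H₂] [CompleteSpace H₂]

/-- For a closed subspace `Γ` of `H₁ × H₂`, the components of the orthogonal projection onto `Γ`
restricted to `0 × H₂`. -/
theorem exists_graph_projection (Γ : Submodule ℂ (H₁ × H₂)) (hΓ : IsClosed (Γ : Set (H₁ × H₂))) :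
    ∃ (B : H₂ →L[ℂ] H₁) (S : H₂ →L[ℂ] H₂), (∀ v, (B v, S v) ∈ Γ) ∧
      ∀ v, ∀ p ∈ Γ, ⟪B v, p.1⟫_ℂ + ⟪S v, p.2⟫_ℂ = ⟪v, p.2⟫_ℂ := by
  -- The product carries the sup norm; orthogonal projection needs the equivalent Hilbert norm.
  let e := WithLp.prodContinuousLinearEquiv 2 ℂ H₁ H₂
  let K : Submodule ℂ (WithLp 2 (H₁ × H₂)) := Γ.comap e.toLinearMap
  have hK : IsClosed (K : Set (WithLp 2 (H₁ × H₂))) := hΓ.preimage e.continuous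
  have : CompleteSpace K := hK.completeSpace_coe
  let R : H₂ →L[ℂ] H₁ × H₂ := (e : WithLp 2 (H₁ × H₂) →L[ℂ] H₁ × H₂) ∘L K.starProjection ∘L
    (e.symm : H₁ × H₂ →L[ℂ] WithLp 2 (H₁ × H₂)) ∘L ContinuousLinearMap.inr ℂ H₁ H₂
  refine ⟨ContinuousLinearMap.fst ℂ H₁ H₂ ∘L R, ContinuousLinearMap.snd ℂ H₁ H₂ ∘L R, ?_, ?_⟩
  · intro v
    exact Submodule.starProjection_apply_mem K (e.symm (0, v))
  · intro v p hp
    have h := Submodule.starProjection_inner_eq_zero (K := K) (e.symm (0, v)) (e.symm p)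
      (show e (e.symm p) ∈ Γ by simpa using hp)
    rw [inner_sub_left, sub_eq_zero, WithLp.prod_inner_apply, WithLp.prod_inner_apply] at h
    have h0 : ⟪(0 : H₁), p.1⟫_ℂ + ⟪v, p.2⟫_ℂ =
      ⟪(ContinuousLinearMap.fst ℂ H₁ H₂ ∘L R) v, p.1⟫_ℂ +
        ⟪(ContinuousLinearMap.snd ℂ H₁ H₂ ∘L R) v, p.2⟫_ℂ := h
    rw [← h0, inner_zero_left, zero_add]

omit [CompleteSpace H₁] [CompleteSpace H₂] in
theorem graph_projection_unique {Γ : Submodule ℂ (H₁ × H₂)} {v : H₂} {p q : H₁ × H₂}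
    (hp : p ∈ Γ) (hq : q ∈ Γ) (hpv : ∀ r ∈ Γ, ⟪p.1, r.1⟫_ℂ + ⟪p.2, r.2⟫_ℂ = ⟪v, r.2⟫_ℂ)
    (hqv : ∀ r ∈ Γ, ⟪q.1, r.1⟫_ℂ + ⟪q.2, r.2⟫_ℂ = ⟪v, r.2⟫_ℂ) : p = q := by
  have h1 := hpv (p - q) (Γ.sub_mem hp hq)
  rw [← hqv (p - q) (Γ.sub_mem hp hq)] at h1
  have h2 : ⟪p.1 - q.1, p.1 - q.1⟫_ℂ + ⟪p.2 - q.2, p.2 - q.2⟫_ℂ = 0 := by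
    rw [inner_sub_left, inner_sub_left]
    simp only [Prod.fst_sub, Prod.snd_sub] at h1
    linear_combination h1
  have h3 : ‖p.1 - q.1‖ ^ 2 + ‖p.2 - q.2‖ ^ 2 = 0 := by
    simpa only [map_add, inner_self_eq_norm_sq, map_zero] using congrArg (RCLike.re (K := ℂ)) h2
  have h4 := sq_nonneg ‖p.1 - q.1‖
  have h5 := sq_nonneg ‖p.2 - q.2‖
  refine Prod.ext (sub_eq_zero.1 (norm_eq_zero.1 (pow_eq_zero_iff two_ne_zero |>.1 ?_)))
    (sub_eq_zero.1 (norm_eq_zero.1 (pow_eq_zero_iff two_ne_zero |>.1 ?_))) <;> linarith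

omit [CompleteSpace H₁] [CompleteSpace H₂] in
-- By invariance of `Γ`, the translate of the projection of `(0, v)` has the defining properties of
-- the projection of `(0, ρ s v)`.
theorem graph_projection_intertwines {G : Type*} [Group G] {π : G →* (H₁ ≃ₗᵢ[ℂ] H₁)}
    {ρ : G →* (H₂ ≃ₗᵢ[ℂ] H₂)} {Γ : Submodule ℂ (H₁ × H₂)}
    (hinv : ∀ s, ∀ p ∈ Γ, (π s p.1, ρ s p.2) ∈ Γ) {B : H₂ →L[ℂ] H₁} {S : H₂ →L[ℂ] H₂}
    (hmem : ∀ v, (B v, S v) ∈ Γ)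
    (hinner : ∀ v, ∀ p ∈ Γ, ⟪B v, p.1⟫_ℂ + ⟪S v, p.2⟫_ℂ = ⟪v, p.2⟫_ℂ) :
    Intertwines ρ π B ∧ Intertwines ρ ρ S := by
  have key : ∀ s v, (B (ρ s v), S (ρ s v)) = (π s (B v), ρ s (S v)) := fun s v => by
    refine graph_projection_unique (v := ρ s v) (hmem _) (hinv s _ (hmem v)) (hinner _) ?_
    intro r hr
    simp only [inner_rep_left]
    exact hinner v _ (hinv s⁻¹ r hr)
  exact ⟨fun s v => congrArg Prod.fst (key s v), fun s v => congrArg Prod.snd (key s v)⟩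

/-- Testing the projection identity on points `(B v, S v)` of `Γ` yields `S = B* B + S* S`. -/
theorem graph_projection_nonneg {Γ : Submodule ℂ (H₁ × H₂)} {B : H₂ →L[ℂ] H₁} {S : H₂ →L[ℂ] H₂}
    (hmem : ∀ v, (B v, S v) ∈ Γ)
    (hinner : ∀ v, ∀ p ∈ Γ, ⟪B v, p.1⟫_ℂ + ⟪S v, p.2⟫_ℂ = ⟪v, p.2⟫_ℂ) : 0 ≤ S := by
  have hS : S = B.adjoint ∘L B + S.adjoint ∘L S := by
    ext1 v
    refine ext_inner_left ℂ fun w => ?_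
    rw [← hinner w _ (hmem v), add_apply, inner_add_right, ContinuousLinearMap.comp_apply,
      ContinuousLinearMap.comp_apply, ContinuousLinearMap.adjoint_inner_right,
      ContinuousLinearMap.adjoint_inner_right]
  rw [hS, ContinuousLinearMap.nonneg_iff_isPositive]
  exact (ContinuousLinearMap.isPositive_adjoint_comp_self B).add
    (ContinuousLinearMap.isPositive_adjoint_comp_self S)

/-- The kernel of `(δ - S)⁺` is contained in the range of `S`. -/
theorem mem_range_of_cfc_eq_zero {S : H₂ →L[ℂ] H₂} (hS : 0 ≤ S) {δ : ℝ} (hδ : 0 < δ) {v : H₂}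
    (hv : cfc (fun t : ℝ => max (δ - t) 0) S v = 0) : ∃ w, S w = v := by
  have hsa : IsSelfAdjoint S := hS.isSelfAdjoint
  have hg : Continuous fun t : ℝ => (max t δ)⁻¹ :=
    (by fun_prop : Continuous fun t : ℝ => max t δ).inv₀ fun t => (lt_max_of_lt_right hδ).ne'
  have hg' : Continuous fun t : ℝ => t * (max t δ)⁻¹ := continuous_id'.mul hg
  -- Functional calculus form of `t / max(t, δ) + (δ - t)⁺ / δ = 1`.
  have h1 : S * cfc (fun t : ℝ => (max t δ)⁻¹) S +
      δ⁻¹ • cfc (fun t : ℝ => max (δ - t) 0) S = 1 := by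
    conv_lhs => enter [1, 1]; rw [← cfc_id' ℝ S]
    rw [← cfc_mul _ _ S (by fun_prop) hg.continuousOn, ← cfc_smul _ _ S (by fun_prop),
      ← cfc_add S _ _ hg'.continuousOn (by fun_prop), ← cfc_const_one ℝ S]
    refine cfc_congr fun t _ => ?_
    simp only [smul_eq_mul]
    rcases le_total t δ with h | h
    · rw [max_eq_right h, max_eq_left (by linarith)]; field_simp; ring
    · rw [max_eq_left h, max_eq_right (by linarith), mul_inv_cancel₀ (by linarith)]; ring
  refine ⟨cfc (fun t : ℝ => (max t δ)⁻¹) S v, ?_⟩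
  have h2 := congrArg (fun C : H₂ →L[ℂ] H₂ => C v) h1
  simpa [hv] using h2

/-- On the orthogonal complement of the kernel of `(δ - S)⁺`, the positive operator `S` is bounded
by `δ`. -/
theorem norm_sq_le_of_mem_orthogonal_ker {S : H₂ →L[ℂ] H₂} (hS : 0 ≤ S) {δ : ℝ} {v : H₂}
    (hv : v ∈ (cfc (fun t : ℝ => max (δ - t) 0) S).kerᗮ) :
    ‖S v‖ ^ 2 ≤ δ * (⟪v, S v⟫_ℂ).re := by
  have hsa : IsSelfAdjoint S := hS.isSelfAdjoint
  set F : H₂ →L[ℂ] H₂ := cfc (fun t : ℝ => max (δ - t) 0) S with hF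
  have hFsa : F.adjoint = F := (cfc_predicate (fun t : ℝ => max (δ - t) 0) S).adjoint_eq
  -- The corresponding function is `((δ - t)⁺)² · t(δ - t)`, nonnegative for `t ≥ 0`. It gives the
  -- estimate on the range of `F`, which is dense in `(ker F)ᗮ`.
  have hpos : 0 ≤ F * (δ • S - S * S) * F := by
    have : F * (δ • S - S * S) * F =
        cfc (fun t : ℝ => max (δ - t) 0 * (δ * t - t * t) * max (δ - t) 0) S := by
      rw [cfc_mul _ _ S (by fun_prop) (by fun_prop), cfc_mul _ _ S (by fun_prop) (by fun_prop),
        cfc_sub _ _ S (by fun_prop) (by fun_prop), cfc_const_mul _ _ S (by fun_prop),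
        cfc_mul (fun t : ℝ => t) (fun t => t) S (by fun_prop) (by fun_prop), cfc_id' ℝ S]
    rw [this]
    refine cfc_nonneg fun t ht => ?_
    have ht0 : 0 ≤ t := spectrum_nonneg_of_nonneg hS ht
    rcases le_total t δ with h | h
    · rw [max_eq_left (by linarith)]
      have : 0 ≤ δ - t := by linarith
      have : 0 ≤ δ * t - t * t := by nlinarith
      positivity
    · rw [max_eq_right (by linarith)]; simp
  have hrange : ∀ y, ‖S (F y)‖ ^ 2 ≤ δ * (⟪F y, S (F y)⟫_ℂ).re := by
    intro y
    have h1 := ((ContinuousLinearMap.nonneg_iff_isPositive _).1 hpos).re_inner_nonneg_right y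
    have h2 : ⟪y, (F * (δ • S - S * S) * F) y⟫_ℂ =
        (δ : ℂ) * ⟪F y, S (F y)⟫_ℂ - ⟪S (F y), S (F y)⟫_ℂ := by
      change ⟪y, F (δ • S (F y) - S (S (F y)))⟫_ℂ = _
      conv_lhs => rw [← hFsa, ContinuousLinearMap.adjoint_inner_right]
      rw [inner_sub_right, hFsa]
      congr 1
      · rw [← Complex.coe_smul, inner_smul_right]
      · rw [← ContinuousLinearMap.adjoint_inner_left, hsa.adjoint_eq]
    rw [h2, inner_self_eq_norm_sq_to_K] at h1
    have h3 : 0 ≤ δ * (⟪F y, S (F y)⟫_ℂ).re - ‖S (F y)‖ ^ 2 := by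
      simpa [← Complex.ofReal_pow] using h1
    linarith
  rw [ContinuousLinearMap.orthogonal_ker, hFsa] at hv
  have hcl : IsClosed {v : H₂ | ‖S v‖ ^ 2 ≤ δ * (⟪v, S v⟫_ℂ).re} :=
    isClosed_le (by fun_prop) (by fun_prop)
  exact closure_minimal (by rintro _ ⟨y, rfl⟩; exact hrange y) hcl hv

/-- A closed operator is bounded below on the part of the preimage of a closed subspace of its
range which is orthogonal to its kernel. -/
theorem exists_norm_le_of_closed_le_range {A : H₁ →ₗ.[ℂ] H₂} (hA : A.IsClosed) (Q : Submodule ℂ H₂)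
    (hQ : IsClosed (Q : Set H₂)) (hQA : Q ≤ LinearMap.range A.toFun)
    (N : Submodule ℂ H₁) (hN : IsClosed (N : Set H₁)) (hNA : ∀ x, x ∈ N ↔ (x, (0 : H₂)) ∈ A.graph) :
    ∃ c : ℝ, ∀ p ∈ A.graph, p.1 ∈ Nᗮ → p.2 ∈ Q → ‖p.1‖ ≤ c * ‖p.2‖ := by
  have : CompleteSpace Q := hQ.completeSpace_coe
  have : CompleteSpace N := hN.completeSpace_coe
  -- On this closed part of the graph the second projection is a bijection onto `Q`: injective
  -- because kernel vectors are excluded, surjective after subtracting the kernel component of a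
  -- preimage. The constant is the norm of its inverse.
  let Y : Submodule ℂ (H₁ × H₂) := A.graph ⊓ Nᗮ.prod Q
  have hY : IsClosed (Y : Set (H₁ × H₂)) := by
    refine IsClosed.inter hA ?_
    rw [Submodule.prod_coe]
    exact (Submodule.isClosed_orthogonal N).prod hQ
  have : CompleteSpace Y := hY.completeSpace_coe
  let f : Y →L[ℂ] Q := (ContinuousLinearMap.snd ℂ H₁ H₂ ∘L Y.subtypeL).codRestrict Q
    fun p => p.2.2.2
  have hinj : LinearMap.ker f.toLinearMap = ⊥ := by
    rw [LinearMap.ker_eq_bot']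
    rintro ⟨⟨x, y⟩, hg, hx, hy⟩ h0
    have hy0 : y = 0 := congrArg Subtype.val h0
    subst hy0
    have : x = 0 := inner_self_eq_zero.1 (hx x ((hNA x).2 hg))
    subst this
    rfl
  have hsurj : LinearMap.range f.toLinearMap = ⊤ := by
    rw [LinearMap.range_eq_top]
    rintro ⟨y, hy⟩
    obtain ⟨x, hx⟩ := hQA hy
    have hg : ((x : H₁), y) ∈ A.graph := A.mem_graph_iff.2 ⟨x, rfl, hx⟩
    have hg' : ((x : H₁) - N.starProjection x, y) ∈ A.graph := by
      have := A.graph.sub_mem hg ((hNA _).1 (Submodule.starProjection_apply_mem N (x : H₁)))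
      simpa using this
    exact ⟨⟨((x : H₁) - N.starProjection x, y), hg',
      Submodule.sub_starProjection_mem_orthogonal _, hy⟩, rfl⟩
  let e := ContinuousLinearEquiv.ofBijective f hinj hsurj
  refine ⟨‖(e.symm : Q →L[ℂ] Y)‖, fun p hp hp1 hp2 => ?_⟩
  have h1 : e.symm ⟨p.2, hp2⟩ = ⟨p, hp, hp1, hp2⟩ := by
    rw [ContinuousLinearEquiv.symm_apply_eq]; rfl
  have h2 := (e.symm : Q →L[ℂ] Y).le_opNorm ⟨p.2, hp2⟩
  rw [ContinuousLinearEquiv.coe_coe, h1] at h2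
  exact (norm_fst_le p).trans h2

end HilbertSpace

end GFredholm
end

/-! ### Restriction of a `G`-Fredholm operator -/

noncomputable section

namespace GFredholm

section Fredholm

universe u v w

variable {G : Type v} [Group G] [TopologicalSpace G] [IsTopologicalGroup G] [MeasurableSpace G]
  [BorelSpace G] {μ : Measure G} [μ.IsMulRightInvariant]
variable {V : Type u} [NormedAddCommGroup V] [InnerProductSpace ℂ V] [CompleteSpace V]
variable {W : Type w} [NormedAddCommGroup W] [InnerProductSpace ℂ W] [CompleteSpace W]
variable {M : HilbertGModule μ V} {N : HilbertGModule μ W} {A : V →ₗ.[ℂ] W}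

/-- The orthogonal complement of a closed invariant subspace. -/
def HilbertGModule.ClosedInvariant.orthogonal (L : M.ClosedInvariant) : M.ClosedInvariant where
  carrier := L.carrierᗮ
  isClosed := Submodule.isClosed_orthogonal _
  invariant s x hx y hy := by
    rw [← inner_conj_symm, inner_rep_left, inner_conj_symm]
    exact hx _ (L.invariant _ y hy)

omit [CompleteSpace V] [CompleteSpace W] in
theorem mem_kernel_iff (A : V →ₗ.[ℂ] W) (x : V) : x ∈ kernel A ↔ (x, (0 : W)) ∈ A.graph := by
  rw [LinearPMap.mem_graph_iff, kernel, Submodule.mem_map]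
  exact ⟨fun ⟨y, hy, e⟩ => ⟨y, e, hy⟩, fun ⟨y, e, hy⟩ => ⟨y, hy, e⟩⟩

theorem CommutesWithAction.mem_graph (hA : CommutesWithAction M N A) (s : G) {p : V × W}
    (hp : p ∈ A.graph) : (M.rep s p.1, N.rep s p.2) ∈ A.graph := by
  rw [LinearPMap.mem_graph_iff] at hp ⊢
  obtain ⟨x, hx, hy⟩ := hp
  obtain ⟨h, e⟩ := hA s x
  exact ⟨⟨_, h⟩, by rw [← hx], by rw [← hy, e]⟩

/-- The kernel of a closed invariant operator, as a closed invariant subspace. -/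
def kernelClosedInvariant (hcl : A.IsClosed) (hA : CommutesWithAction M N A) :
    M.ClosedInvariant where
  carrier := kernel A
  isClosed := by
    have : (kernel A : Set V) = (fun x => (x, (0 : W))) ⁻¹' (A.graph : Set (V × W)) :=
      Set.ext fun x => mem_kernel_iff A x
    rw [this]
    exact hcl.preimage (by fun_prop)
  invariant s x hx := by
    rw [mem_kernel_iff] at hx ⊢
    simpa using hA.mem_graph s hx

theorem mem_graph_restriction_iff (hA : CommutesWithAction M N A) (L : M.ClosedInvariant)
    (p : L.carrier × (closureImage hA L).carrier) :
    p ∈ (restriction hA L).graph ↔ ((p.1 : V), (p.2 : W)) ∈ A.graph := by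
  rw [LinearPMap.mem_graph_iff, LinearPMap.mem_graph_iff]
  constructor
  · rintro ⟨x, hx, hy⟩
    exact ⟨⟨x.1.1, x.2⟩, congrArg Subtype.val hx, congrArg Subtype.val hy⟩
  · rintro ⟨x, hx, hy⟩
    have hx' : (x : V) = (p.1 : V) := hx
    refine ⟨⟨p.1, show (p.1 : V) ∈ A.domain from hx' ▸ x.2⟩, rfl, Subtype.ext ?_⟩
    refine Eq.trans ?_ hy
    change A ⟨(p.1 : V), _⟩ = A x
    congr 1
    exact Subtype.ext hx'.symm

theorem isClosed_restriction (hcl : A.IsClosed) (hA : CommutesWithAction M N A)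
    (L : M.ClosedInvariant) : (restriction hA L).IsClosed := by
  have : ((restriction hA L).graph : Set (L.carrier × (closureImage hA L).carrier)) =
      (fun p => ((p.1 : V), (p.2 : W))) ⁻¹' (A.graph : Set (V × W)) :=
    Set.ext fun p => mem_graph_restriction_iff hA L p
  rw [LinearPMap.IsClosed, this]
  exact IsClosed.preimage (by fun_prop) hcl

theorem commutesWithAction_restriction (hA : CommutesWithAction M N A) (L : M.ClosedInvariant) :
    CommutesWithAction (M.restrict L) (N.restrict (closureImage hA L)) (restriction hA L) := by
  intro s x
  obtain ⟨h, e⟩ := hA s ⟨x.1.1, x.2⟩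
  exact ⟨h, Subtype.ext e⟩

variable [T2Space G] [SecondCountableTopology G] [LocallyCompactSpace G] [μ.IsHaarMeasure]

theorem dim_kernel_restriction_lt_top (hcl : A.IsClosed) (hA : CommutesWithAction M N A)
    (hdim : M.dim (kernel A) < ⊤) (L : M.ClosedInvariant) :
    (M.restrict L).dim (kernel (restriction hA L)) < ⊤ := by
  let K := kernelClosedInvariant hcl hA
  let K' := kernelClosedInvariant (isClosed_restriction hcl hA L)
    (commutesWithAction_restriction hA L)
  have hmem : ∀ x : K'.carrier, ((x : L.carrier) : V) ∈ K.carrier := fun x =>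
    (mem_kernel_iff A _).2 ((mem_graph_restriction_iff hA L _).1 ((mem_kernel_iff _ _).1 x.2))
  refine dim_lt_top_of_finiteGDim (M.restrict L) K' ?_
  refine FiniteGDim.of_injective (M.stronglyContinuous_subRep K)
    (finiteGDim_of_dim_lt_top M K hdim)
    (C := (L.carrier.subtypeL ∘L K'.carrier.subtypeL).codRestrict K.carrier hmem)
    (fun s x => rfl) fun x hx => ?_
  exact Subtype.ext (Subtype.ext (congrArg (fun y : K.carrier => (y : V)) hx))

theorem exists_codim_restriction_lt_top (hcl : A.IsClosed) (hA : CommutesWithAction M N A)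
    (hdim : M.dim (kernel A) < ⊤) (Q : N.ClosedInvariant)
    (hQA : Q.carrier ≤ LinearMap.range A.toFun) (hQ : N.dim Q.carrierᗮ < ⊤)
    (L : M.ClosedInvariant) :
    ∃ Q' : (N.restrict (closureImage hA L)).ClosedInvariant,
      Q'.carrier ≤ LinearMap.range (restriction hA L).toFun ∧
        (N.restrict (closureImage hA L)).dim Q'.carrierᗮ < ⊤ := by
  let K := kernelClosedInvariant hcl hA
  obtain ⟨c, hc⟩ := exists_norm_le_of_closed_le_range hcl Q.carrier Q.isClosed hQA K.carrier
    K.isClosed (mem_kernel_iff A)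
  let Γ : Submodule ℂ (V × W) := A.graph ⊓ L.carrier.comap (LinearMap.fst ℂ V W)
  have hΓ : IsClosed (Γ : Set (V × W)) := IsClosed.inter hcl (L.isClosed.preimage continuous_fst)
  have hΓinv : ∀ s, ∀ p ∈ Γ, (M.rep s p.1, N.rep s p.2) ∈ Γ := fun s p hp =>
    ⟨hA.mem_graph s hp.1, L.invariant s _ hp.2⟩
  have hΓim : ∀ p ∈ Γ, p.2 ∈ image A L.carrier := by
    rintro p ⟨hp, hpL⟩
    obtain ⟨x, hx, hy⟩ := A.mem_graph_iff.1 hp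
    exact ⟨x, show (x : V) ∈ L.carrier from hx ▸ hpL, hy⟩
  obtain ⟨B, S, hmem, hinner⟩ := exists_graph_projection Γ hΓ
  obtain ⟨hB, hS⟩ := graph_projection_intertwines hΓinv hmem hinner
  have hS0 : 0 ≤ S := graph_projection_nonneg hmem hinner
  -- The cut-off is chosen so small that `‖S v‖² ≤ δ(c² + 1)‖S v‖²` forces `S v = 0`.
  obtain ⟨δ, hδ, hδc⟩ : ∃ δ : ℝ, 0 < δ ∧ δ * (c ^ 2 + 1) < 1 :=
    ⟨(2 * (c ^ 2 + 1))⁻¹, by positivity, by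
      rw [mul_inv, mul_assoc, inv_mul_cancel₀ (by positivity)]; norm_num⟩
  let F : W →L[ℂ] W := cfc (fun t : ℝ => max (δ - t) 0) S
  have hF : Intertwines N.rep N.rep F := hS.cfc_real _
  let X := closureImage hA L
  have hFX : ∀ v, F v = 0 → ∃ w, S w = v := fun v => mem_range_of_cfc_eq_zero hS0 hδ
  let Q' : (N.restrict X).ClosedInvariant :=
    { carrier := F.ker.comap X.carrier.subtype
      isClosed := isClosed_eq (F.continuous.comp continuous_subtype_val) continuous_const
      invariant := fun s x hx => by
        change F (N.rep s x) = 0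
        rw [hF, show F x = 0 from hx, map_zero] }
  refine ⟨Q', ?_, ?_⟩
  · intro y hy
    obtain ⟨w, hw⟩ := hFX y hy
    obtain ⟨hwA, hwL⟩ := hmem w
    obtain ⟨x, hx, hxy⟩ := (restriction hA L).mem_graph_iff.1
      ((mem_graph_restriction_iff hA L (⟨B w, hwL⟩, y)).2 (by rw [← hw]; exact hwA))
    exact ⟨x, hxy⟩
  · let Y := Q'.orthogonal
    let C : Y.carrier →L[ℂ] W := X.carrier.subtypeL ∘L Y.carrier.subtypeL
    have hC : Intertwines ((N.restrict X).subRep Y) N.rep C := fun s x => rfl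
    let Qo := Q.orthogonal
    refine dim_lt_top_of_finiteGDim (N.restrict X) Y ?_
    -- The jointly injective pair is `v ↦ P_{ker A} (B v)` and `v ↦ P_{Qᗮ} (S v)`.
    refine FiniteGDim.of_injective_pair (M.stronglyContinuous_subRep K)
      (N.stronglyContinuous_subRep Qo) (finiteGDim_of_dim_lt_top M K hdim)
      (finiteGDim_of_dim_lt_top N Qo hQ)
      ((intertwines_orthogonalProjectionOnto M K).comp (hB.comp hC))
      ((intertwines_orthogonalProjectionOnto N Qo).comp (hS.comp hC)) fun x h1 h2 => ?_
    obtain ⟨v, hv⟩ : ∃ v, v = C x := ⟨_, rfl⟩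
    -- `v` is orthogonal to `Q'` only inside `X`; since `ker F ⊆ range S ⊆ A(L) ⊆ X`, this is
    -- orthogonality to all of `ker F`.
    have hvF : v ∈ F.kerᗮ := by
      intro w hw
      obtain ⟨w', hw'⟩ := hFX w hw
      have hwX : w ∈ X.carrier :=
        hw' ▸ Submodule.le_topologicalClosure _ (hΓim _ (hmem w'))
      rw [hv]
      exact x.2 ⟨w, hwX⟩ hw
    have hBv : B v ∈ K.carrierᗮ := by
      rw [hv]
      exact Submodule.orthogonalProjectionOnto_eq_zero_iff.1 h1
    have hSv : S v ∈ Q.carrier := by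
      have : S (C x) ∈ Q.carrierᗮᗮ := Submodule.orthogonalProjectionOnto_eq_zero_iff.1 h2
      rwa [Submodule.orthogonal_orthogonal, ← hv] at this
    have hle : ‖S v‖ ^ 2 ≤ δ * (‖B v‖ ^ 2 + ‖S v‖ ^ 2) := by
      have h3 := norm_sq_le_of_mem_orthogonal_ker hS0 hvF
      rw [← hinner v _ (hmem v)] at h3
      simpa [inner_self_eq_norm_sq_to_K, ← Complex.ofReal_pow] using h3
    have hcv : ‖B v‖ ≤ c * ‖S v‖ := hc _ (hmem v).1 hBv hSv
    have hS0v : ‖S v‖ = 0 := by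
      have h4 : ‖B v‖ ^ 2 ≤ c ^ 2 * ‖S v‖ ^ 2 := by
        rw [← mul_pow]; gcongr
      have h5 : 0 ≤ (1 - δ * (c ^ 2 + 1)) := by linarith
      by_contra hne
      have h6 : 0 < ‖S v‖ ^ 2 := by positivity
      nlinarith [mul_pos (sub_pos.2 hδc) h6, mul_le_mul_of_nonneg_left h4 hδ.le]
    have hB0v : B v = 0 := by
      rw [hS0v, mul_zero] at hcv
      exact norm_le_zero_iff.1 hcv
    -- The projection of `(0, v)` onto `Γ` is zero, so `v` is orthogonal to the second components of
    -- `Γ`.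
    have horth : ∀ y ∈ image A L.carrier, ⟪v, y⟫_ℂ = 0 := by
      rintro _ ⟨z, hz, rfl⟩
      have := hinner v ((z : V), A z) ⟨A.mem_graph_iff.2 ⟨z, rfl, rfl⟩, hz⟩
      rw [hB0v, norm_eq_zero.1 hS0v, inner_zero_left, inner_zero_left, add_zero] at this
      exact this.symm
    have hvX : v ∈ closure (image A L.carrier : Set W) := by
      rw [hv]
      exact x.1.2
    have hv0 : ⟪v, v⟫_ℂ = 0 :=
      closure_minimal (t := {y | ⟪v, y⟫_ℂ = 0}) horth
        (isClosed_eq (by fun_prop) continuous_const) hvX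
    refine Subtype.ext (Subtype.ext ?_)
    change C x = 0
    rw [← hv]
    exact inner_self_eq_zero.1 hv0

theorem FredholmConditions.restriction (hA : FredholmConditions M N A) (L : M.ClosedInvariant) :
    FredholmConditions (M.restrict L) (N.restrict (closureImage hA.commutes L))
      (GFredholm.restriction hA.commutes L) where
  closed := isClosed_restriction hA.closed hA.commutes L
  commutes := commutesWithAction_restriction hA.commutes L
  dim_kernel_lt_top := dim_kernel_restriction_lt_top hA.closed hA.commutes hA.dim_kernel_lt_top L
  exists_codim_lt_top := by
    obtain ⟨Q, hQA, hQ⟩ := hA.exists_codim_lt_top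
    exact exists_codim_restriction_lt_top hA.closed hA.commutes hA.dim_kernel_lt_top Q hQA hQ L

end Fredholm

end GFredholm
end
theorem mainTheorem9
    {E : Type*} [NormedAddCommGroup E] [NormedSpace ℝ E] [FiniteDimensional ℝ E]
    {G : Type*} [Group G] [TopologicalSpace G] [IsTopologicalGroup G] [T2Space G]
    [SecondCountableTopology G] [ChartedSpace E G] [LieGroup 𝓘(ℝ, E) ∞ G]
    [MeasurableSpace G] [BorelSpace G]
    (μ : MeasureTheory.Measure G) [μ.IsHaarMeasure] [μ.IsMulRightInvariant]
    {H₁ : Type*} [NormedAddCommGroup H₁] [InnerProductSpace ℂ H₁] [CompleteSpace H₁]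
    {H₂ : Type*} [NormedAddCommGroup H₂] [InnerProductSpace ℂ H₂] [CompleteSpace H₂]
    (M₁ : GFredholm.HilbertGModule μ H₁) (M₂ : GFredholm.HilbertGModule μ H₂)
    (A : H₁ →ₗ.[ℂ] H₂) (hA : GFredholm.IsGFredholm M₁ M₂ A)
    (L : M₁.ClosedInvariant) :
    GFredholm.FredholmConditions (M₁.restrict L)
        (M₂.restrict (GFredholm.closureImage hA.commutes L))
        (GFredholm.restriction hA.commutes L) ∧
      (Dense ((GFredholm.restriction hA.commutes L).domain : Set L.carrier) →
        GFredholm.IsGFredholm (M₁.restrict L)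
          (M₂.restrict (GFredholm.closureImage hA.commutes L))
          (GFredholm.restriction hA.commutes L)) := by
  have : ProperSpace E := FiniteDimensional.proper ℝ E
  have : LocallyCompactSpace G := ChartedSpace.locallyCompactSpace E G
  have h := hA.toFredholmConditions.restriction L
  exact ⟨h, fun hd => ⟨h, hd⟩⟩
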